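/- Let $E\subset\mathbb{C}$ be a compact set with connected complement and $0\in\operatorname{int}E$. Assume that $E$ is uniformly perfect: there is $a>0$ such that for all $z\in E$ and $0<r<\operatorname{diam}E$ some $w\in E$ satisfies $ar\le|z-w|\le r$. For a Borel probability measure $\mu$ supported on $E$ put $I(\mu)=\iint\log|z-w|\,d\mu(z)\,d\mu(w)\in[-\infty,\infty)$. Let $\nu$ be the equilibrium measure of $E$, i.e. the Borel probability measure supported on $E$ that maximizes $I$, and let $\operatorname{cap}(E)=e^{I(\nu)}$. Let $(q_n)_{n\ge1}$ be a sequence of monic polynomials with complex coefficients, $\deg q_n=n$, all of whose zeros lie in $\partial E$, such that the measures $\mu_n=\frac1n\sum_{\zeta}\delta_\zeta$, where $\zeta$ runs over the zeros of $q_n$ counted with multiplicity, converge weak* to $\nu$ as $n\to\infty$. For $s>0$ and $n\ge1$ set $$P_{n,s}(z)=z\,\frac{e^{-ns/2}}{\operatorname{cap}(E)^n}\,q_n(z),$$ and for a polynomial $P$ let $\mathcal K(P)=\{z\in\mathbb{C}: P^m(z)\not\to\infty \text{ as } m\to\infty\}$ be its filled Julia set, where $P^m$ is the $m$-th iterate.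 Then for every bounded neighborhood $U$ of $E$ there exist $s>0$ and $n\ge1$ such that $$E\subset\operatorname{int}\mathcal K(P_{n,s})\subset U.$$ -/

import Mathlib

open MeasureTheory Filter Topology Polynomial
open scoped ENNReal NNReal

namespace JuliaApprox

noncomputable section

/-- The integral, in `[-∞, ∞]`, of an extended-real function: the integral of the positive part
minus the integral of the negative part. It is used below only where the positive part has a
finite integral. -/
def erealIntegral {α : Type*} [MeasurableSpace α] (μ : Measure α) (f : α → EReal) : EReal :=
  ((∫⁻ x, (f x).toENNReal ∂μ : ℝ≥0∞) : EReal) - ((∫⁻ x, (-f x).toENNReal ∂μ : ℝ≥0∞) : EReal)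

/-- The logarithmic energy `I(μ) = ∬ log |z - w| dμ(z) dμ(w)`, with `log 0 = -∞`. On a measure with
compact support the kernel is bounded above, and the value lies in `[-∞, ∞)`. -/
def logEnergy (μ : Measure ℂ) : EReal :=
  erealIntegral (μ.prod μ) (fun p : ℂ × ℂ => ENNReal.log ‖p.1 - p.2‖ₑ)

/-- `𝒫(E)`: the Borel probability measures on `ℂ` supported on the (closed) set `E`. -/
def probOn (E : Set ℂ) : Set (ProbabilityMeasure ℂ) :=
  {μ | (μ : Measure ℂ) Eᶜ = 0}

/-- The supremum of the energies `I(μ)` over `μ ∈ 𝒫(E)`. -/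
def maxEnergy (E : Set ℂ) : EReal :=
  ⨆ μ ∈ probOn E, logEnergy (μ : Measure ℂ)

/-- `ν` is an equilibrium measure of `E`: it lies in `𝒫(E)` and maximizes the energy there. -/
def IsEquilibriumMeasure (E : Set ℂ) (ν : ProbabilityMeasure ℂ) : Prop :=
  ν ∈ probOn E ∧ logEnergy (ν : Measure ℂ) = maxEnergy E

/-- The logarithmic capacity `cap(E) = exp (sup_{μ ∈ 𝒫(E)} I(μ))`, which is `exp (I(ν))` for any
equilibrium measure `ν` of `E`. -/
def logCapacity (E : Set ℂ) : ℝ :=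
  (EReal.exp (maxEnergy E)).toReal

/-- `E` is uniformly perfect: for some `a > 0`, every `z ∈ E` and every `0 < r < diam E`, some
`w ∈ E` satisfies `a r ≤ |z - w| ≤ r`. -/
def IsUniformlyPerfect (E : Set ℂ) : Prop :=
  ∃ a : ℝ, 0 < a ∧ ∀ z ∈ E, ∀ r : ℝ, 0 < r → r < Metric.diam E →
    ∃ w ∈ E, a * r ≤ ‖z - w‖ ∧ ‖z - w‖ ≤ r

/-- The normalized counting measure `(1 / deg q) ∑ δ_ζ` of the zeros `ζ` of `q`, each zero
repeated according to its multiplicity. -/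
def zeroCountingMeasure (q : ℂ[X]) : FiniteMeasure ℂ :=
  (q.natDegree : ℝ≥0)⁻¹ • (q.roots.map fun ζ => (diracProba ζ).toFiniteMeasure).sum

/-- The filled Julia set of `P`: the points whose orbit under `P` does not tend to `∞`. -/
def filledJulia (P : ℂ[X]) : Set ℂ :=
  {z | ¬ Tendsto (fun m : ℕ => (fun w => P.eval w)^[m] z) atTop (Bornology.cobounded ℂ)}

/-- The polynomial `P_{n,s}(z) = z (e^{-ns/2} / cap(E)^n) q_n(z)`. -/
def approxPoly (E : Set ℂ) (q : ℕ → ℂ[X]) (n : ℕ) (s : ℝ) : ℂ[X] :=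
  X * C ((Real.exp (-(n * s) / 2) / logCapacity E ^ n : ℝ) : ℂ) * q n

end

end JuliaApprox

/-!
The argument is potential theory. Let `p(z) = ∫ log |z - w| dν(w)` be the logarithmic potential of
the equilibrium measure. The heart is Frostman's theorem in the form `frostman`: `p` is continuous,
equals `log cap E` on all of `E`, and is larger than `log cap E` off `E`. Since the zero
distributions of the `q n` converge to `ν`, the functions `(1/n) log |q n|` converge to `p` locally
uniformly off `E`. So `|q n| / (cap E)^n` grows at some exponential rate `s > 0` off a
neighbourhood `U` of `E`, while, by the maximum modulus principle, its growth rate on a small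
neighbourhood `V` of `E` is at most `s / 4` (`exists_growth_bounds`). The factor `e^{-ns/2}` lies
between the two rates: for large `n` the polynomial `P_{n,s}` maps `V` into a small disc about `0`
inside `E ⊆ V`, and it at least doubles `|z|` off `U` and maps the complement of `U` into itself.
Hence `V` is contained in the filled Julia set, and the complement of `U` escapes.

Potentials are formed with the nonnegative kernel `log⁺ (D / |z - w|)`, valued in `[0, ∞]`, where
`D` is a large multiple of the size of `E`; near `E` this is `log D - log |z - w|`. With this sign
the equilibrium measure minimizes the energy, and the claims above read: the potential is equal to
the energy on `E` and smaller outside. They are obtained as follows.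

* The variation of the energy gives `energy D ν ≤ ∫ potential D ν dμ` for every `μ` of finite energy
  on `E` (`energy_le_lintegral_potential`).
* Uniform perfectness provides, in each disc about a point of `E`, a Cantor measure of controlled
  potential (`exists_measure_potential_le`). Using these as `μ`, with discs shrinking to `z ∈ E`,
  gives `energy D ν ≤ potential D ν z` at every point of `E`, without exceptional set
  (`energy_le_potential`). As the two sides have the same integral, equality holds on a closed set
  that carries `ν`.
* The continuity principle (`eventually_potential_le`) and the maximum principle, based on the mean
  value property on circles, extend the upper bound to the plane (`potential_le_energy`) and make it
  strict off `E`, whose complement is connected (`potential_lt_energy_of_notMem`).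
-/

namespace LogPotential

section

/-! ### The truncated logarithmic kernel and its potentials -/

/-- The kernel `log⁺ (D / |z - w|)` with values in `[0, ∞]`, equal to `∞` on the diagonal. For
`|z - w| ≤ D` it is `log D - log |z - w|`; being nonnegative, it can be integrated without any
integrability hypothesis. -/
noncomputable def logKernel (D : ℝ) (z w : ℂ) : ℝ≥0∞ :=
  (ENNReal.log (ENNReal.ofReal D * ‖z - w‖ₑ⁻¹)).toENNReal

/-- The potential `z ↦ ∫ log⁺ (D / |z - w|) dμ(w)`. -/
noncomputable def potential (D : ℝ) (μ : Measure ℂ) (z : ℂ) : ℝ≥0∞ :=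
  ∫⁻ w, logKernel D z w ∂μ

/-- The energy of `μ` for the kernel `log⁺ (D / |z - w|)`. -/
noncomputable def energy (D : ℝ) (μ : Measure ℂ) : ℝ≥0∞ :=
  ∫⁻ z, potential D μ z ∂μ

variable {D : ℝ} {z w x : ℂ} {ρ c : ℝ} {μ ν : Measure ℂ}

lemma logKernel_self (hD : 0 < D) (z : ℂ) : logKernel D z z = ⊤ := by
  simp [logKernel, ENNReal.mul_top, hD]

lemma logKernel_of_ne (hD : 0 < D) (h : z ≠ w) :
    logKernel D z w = ENNReal.ofReal (Real.log (D / ‖z - w‖)) := by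
  have h1 : 0 < ‖z - w‖ := norm_pos_iff.2 (sub_ne_zero.2 h)
  have h2 : ENNReal.ofReal D * ‖z - w‖ₑ⁻¹ = ENNReal.ofReal (D / ‖z - w‖) := by
    rw [← ofReal_norm, div_eq_mul_inv, ENNReal.ofReal_mul hD.le,
      ENNReal.ofReal_inv_of_pos h1]
  rw [logKernel, h2, ENNReal.log_ofReal_of_pos (by positivity), EReal.toENNReal_of_ne_top
    (EReal.coe_ne_top _), EReal.toReal_coe]

lemma continuous_logKernel (D : ℝ) : Continuous fun p : ℂ × ℂ => logKernel D p.1 p.2 := by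
  unfold logKernel
  refine EReal.continuous_toENNReal.comp (ENNReal.continuous_log.comp ?_)
  refine (ENNReal.continuous_const_mul ENNReal.ofReal_ne_top).comp ?_
  exact continuous_inv.comp (by fun_prop)

lemma continuous_logKernel_right (D : ℝ) (z : ℂ) : Continuous fun w => logKernel D z w := by
  have h := (continuous_logKernel D).comp (Continuous.prodMk_right z)
  simpa only [Function.comp_def] using h

lemma continuous_logKernel_left (D : ℝ) (w : ℂ) : Continuous fun z => logKernel D z w := by
  have h := (continuous_logKernel D).comp (Continuous.prodMk_left w)
  simpa only [Function.comp_def] using h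

lemma logKernel_comm (D : ℝ) (z w : ℂ) : logKernel D z w = logKernel D w z := by
  unfold logKernel
  rw [← neg_sub, enorm_neg]

lemma logKernel_le (hD : 0 < D) (hρ : 0 < ρ) (h : ρ ≤ ‖z - w‖) :
    logKernel D z w ≤ ENNReal.ofReal (Real.log (D / ρ)) := by
  have hne : z ≠ w := by
    rintro rfl
    simp only [sub_self, norm_zero] at h
    linarith
  rw [logKernel_of_ne hD hne]
  have := hρ.trans_le h
  gcongr

lemma le_logKernel (hD : 0 < D) (h : ‖z - w‖ ≤ ρ) :
    ENNReal.ofReal (Real.log (D / ρ)) ≤ logKernel D z w := by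
  by_cases hne : z = w
  · rw [hne, logKernel_self hD]
    exact le_top
  rw [logKernel_of_ne hD hne]
  have : 0 < ‖z - w‖ := norm_pos_iff.2 (sub_ne_zero.2 hne)
  have := this.trans_le h
  gcongr

lemma logKernel_le_add (hD : 0 < D) (hc : 0 < c) (h : ‖x - w‖ ≤ c * ‖z - w‖) :
    logKernel D z w ≤ logKernel D x w + ENNReal.ofReal (Real.log c) := by
  by_cases hx : x = w
  · rw [hx, logKernel_self hD]
    simp
  have hx' : 0 < ‖x - w‖ := norm_pos_iff.2 (sub_ne_zero.2 hx)
  have hz' : 0 < ‖z - w‖ := by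
    by_contra hn
    have : ‖z - w‖ = 0 := le_antisymm (not_lt.1 hn) (norm_nonneg _)
    rw [this, mul_zero] at h
    linarith
  have hz : z ≠ w := sub_ne_zero.1 (norm_pos_iff.1 hz')
  rw [logKernel_of_ne hD hx, logKernel_of_ne hD hz]
  refine le_trans (ENNReal.ofReal_le_ofReal ?_) ENNReal.ofReal_add_le
  rw [← Real.log_mul (by positivity) hc.ne']
  apply Real.log_le_log (by positivity)
  rw [div_mul_eq_mul_div, div_le_div_iff₀ hz' hx', mul_assoc]
  gcongr

lemma lowerSemicontinuous_potential (D : ℝ) (μ : Measure ℂ) :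
    LowerSemicontinuous (potential D μ) := by
  rw [lowerSemicontinuous_iff_le_liminf]
  intro z
  refine le_trans (le_of_eq ?_) (lintegral_liminf_le (u := 𝓝 z) (f := fun z w => logKernel D z w)
    fun z => (continuous_logKernel_right D z).measurable)
  refine lintegral_congr fun w => ?_
  exact (((continuous_logKernel_left D w).tendsto z).liminf_eq).symm

lemma measurable_potential (D : ℝ) (μ : Measure ℂ) : Measurable (potential D μ) :=
  (lowerSemicontinuous_potential D μ).measurable

lemma lintegral_potential_comm (D : ℝ) (μ ν : Measure ℂ) [SFinite μ] [SFinite ν] :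
    ∫⁻ z, potential D ν z ∂μ = ∫⁻ z, potential D μ z ∂ν := by
  unfold potential
  rw [lintegral_lintegral_swap (continuous_logKernel D).measurable.aemeasurable]
  refine lintegral_congr fun w => lintegral_congr fun z => logKernel_comm D _ _

lemma potential_add_smul (D : ℝ) (μ ν : Measure ℂ) (s t : ℝ≥0∞) (z : ℂ) :
    potential D (s • μ + t • ν) z = s * potential D μ z + t * potential D ν z := by
  simp [potential, lintegral_add_measure, lintegral_smul_measure]

lemma energy_eq_lintegral_prod (D : ℝ) (μ : Measure ℂ) [SFinite μ] :
    energy D μ = ∫⁻ p, logKernel D p.1 p.2 ∂(μ.prod μ) := by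
  rw [energy, lintegral_prod _ (continuous_logKernel D).measurable.aemeasurable]
  rfl

/-! ### Comparison with the logarithmic energy -/

lemma logKernel_add_toENNReal_log (hD : 1 ≤ D) (h : ‖z - w‖ ≤ D) :
    logKernel D z w + (ENNReal.log ‖z - w‖ₑ).toENNReal =
      ENNReal.ofReal (Real.log D) + (-ENNReal.log ‖z - w‖ₑ).toENNReal := by
  have hD0 : 0 < D := by linarith
  by_cases hne : z = w
  · subst hne
    simp [logKernel_self hD0]
  have hpos : 0 < ‖z - w‖ := norm_pos_iff.2 (sub_ne_zero.2 hne)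
  rw [logKernel_of_ne hD0 hne, ← ofReal_norm, ENNReal.log_ofReal_of_pos hpos,
    Real.log_div hD0.ne' hpos.ne', ← EReal.coe_neg, EReal.toENNReal_of_ne_top (EReal.coe_ne_top _),
    EReal.toENNReal_of_ne_top (EReal.coe_ne_top _), EReal.toReal_coe, EReal.toReal_coe]
  have h1 := Real.log_le_log hpos h
  have h2 := Real.log_nonneg hD
  rcases le_total 0 (Real.log ‖z - w‖) with h3 | h3
  · rw [← ENNReal.ofReal_add (by linarith) h3,
      ENNReal.ofReal_of_nonpos (p := -Real.log ‖z - w‖) (by linarith)]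
    simp
  · rw [← ENNReal.ofReal_add h2 (by linarith), ENNReal.ofReal_of_nonpos h3, add_zero]
    rfl

lemma logEnergy_eq [IsProbabilityMeasure μ] {E : Set ℂ} (hD : 1 ≤ D)
    (hdiam : ∀ z ∈ E, ∀ w ∈ E, ‖z - w‖ ≤ D) (hμ : μ Eᶜ = 0) :
    JuliaApprox.logEnergy μ = (Real.log D : EReal) - (energy D μ : EReal) := by
  have hE : ∀ᵐ z ∂μ, z ∈ E := hμ
  have h1 : ∀ᵐ p ∂(μ.prod μ), p.1 ∈ E := Measure.quasiMeasurePreserving_fst.ae hE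
  have h2 : ∀ᵐ p ∂(μ.prod μ), p.2 ∈ E := Measure.quasiMeasurePreserving_snd.ae hE
  have hm : Measurable fun p : ℂ × ℂ => ENNReal.log ‖p.1 - p.2‖ₑ :=
    ENNReal.continuous_log.measurable.comp (by fun_prop)
  have hm1 : Measurable fun p : ℂ × ℂ => (ENNReal.log ‖p.1 - p.2‖ₑ).toENNReal :=
    EReal.continuous_toENNReal.measurable.comp hm
  have hm2 : Measurable fun p : ℂ × ℂ => (-ENNReal.log ‖p.1 - p.2‖ₑ).toENNReal :=
    EReal.continuous_toENNReal.measurable.comp (continuous_neg.measurable.comp hm)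
  have hA : ∫⁻ p, (ENNReal.log ‖p.1 - p.2‖ₑ).toENNReal ∂(μ.prod μ)
      ≤ ENNReal.ofReal (Real.log D) := by
    calc _ ≤ ∫⁻ p, ENNReal.ofReal (Real.log D) ∂(μ.prod μ) := by
          refine lintegral_mono_ae ?_
          filter_upwards [h1, h2] with p hp1 hp2
          have := hdiam _ hp1 _ hp2
          rw [← ofReal_norm]
          refine (EReal.toENNReal_le_toENNReal (ENNReal.log_monotone
            (ENNReal.ofReal_le_ofReal this))).trans ?_
          rw [ENNReal.log_ofReal_of_pos (by linarith), EReal.toENNReal_of_ne_top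
            (EReal.coe_ne_top _), EReal.toReal_coe]
      _ = _ := by simp
  have hsum : energy D μ + ∫⁻ p, (ENNReal.log ‖p.1 - p.2‖ₑ).toENNReal ∂(μ.prod μ) =
      ENNReal.ofReal (Real.log D) +
        ∫⁻ p, (-ENNReal.log ‖p.1 - p.2‖ₑ).toENNReal ∂(μ.prod μ) := by
    rw [energy_eq_lintegral_prod, ← lintegral_add_right _ hm1]
    have : ENNReal.ofReal (Real.log D) = ∫⁻ p, ENNReal.ofReal (Real.log D) ∂(μ.prod μ) := by simp
    rw [this, ← lintegral_add_right _ hm2]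
    refine lintegral_congr_ae ?_
    filter_upwards [h1, h2] with p hp1 hp2
    exact logKernel_add_toENNReal_log hD (hdiam _ hp1 _ hp2)
  unfold JuliaApprox.logEnergy JuliaApprox.erealIntegral
  generalize ∫⁻ p, (ENNReal.log ‖p.1 - p.2‖ₑ).toENNReal ∂(μ.prod μ) = A at *
  generalize ∫⁻ p, (-ENNReal.log ‖p.1 - p.2‖ₑ).toENNReal ∂(μ.prod μ) = B at *
  generalize energy D μ = e at *
  have hA' : A ≠ ⊤ := (hA.trans_lt ENNReal.ofReal_lt_top).ne
  lift A to ℝ≥0 using hA'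
  by_cases he : e = ⊤
  · subst he
    have : B = ⊤ := by
      by_contra hB
      exact (ENNReal.add_ne_top.2 ⟨ENNReal.ofReal_ne_top, hB⟩) (by rw [← hsum]; simp)
    subst this
    simp
  · have hB : B ≠ ⊤ := by
      rintro rfl
      exact (ENNReal.add_ne_top.2 ⟨he, ENNReal.coe_ne_top⟩) (by rw [hsum]; simp)
    lift e to ℝ≥0 using he
    lift B to ℝ≥0 using hB
    have h := congrArg ENNReal.toReal hsum
    rw [ENNReal.toReal_add (by simp) (by simp), ENNReal.toReal_add (by simp) (by simp),
      ENNReal.toReal_ofReal (Real.log_nonneg hD)] at h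
    simp only [ENNReal.coe_toReal] at h
    have h' : (A : ℝ) - B = Real.log D - e := by linarith
    have h'' := congrArg Real.toEReal h'
    rw [EReal.coe_sub, EReal.coe_sub] at h''
    exact h''

end

/-! ### The variational inequality for energy minimizers -/

lemma energy_convexComb (D : ℝ) (μ ν : Measure ℂ) [SFinite μ] [SFinite ν] (s t : ℝ≥0∞) :
    energy D (s • ν + t • μ) = s * s * energy D ν
      + 2 * (s * t) * ∫⁻ z, potential D ν z ∂μ + t * t * energy D μ := by
  have h : ∀ η : Measure ℂ, ∫⁻ z, potential D (s • ν + t • μ) z ∂η =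
      s * ∫⁻ z, potential D ν z ∂η + t * ∫⁻ z, potential D μ z ∂η := by
    intro η
    simp_rw [potential_add_smul]
    rw [lintegral_add_left ((measurable_potential D ν).const_mul s),
      lintegral_const_mul _ (measurable_potential D ν),
      lintegral_const_mul _ (measurable_potential D μ)]
  rw [energy, lintegral_add_measure, lintegral_smul_measure, lintegral_smul_measure, h, h,
    lintegral_potential_comm D ν μ, energy, energy]
  simp only [smul_eq_mul]
  ring

lemma le_of_forall_convexComb_le {g J e : ℝ}
    (h : ∀ t : ℝ, 0 < t → t < 1 →
      g ≤ (1 - t) * (1 - t) * g + 2 * ((1 - t) * t) * J + t * t * e) : g ≤ J := by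
  by_contra! hlt
  set c := g - J with hc
  have hc0 : 0 < c := by linarith
  set M := |g| + 2 * |J| + |e| with hM
  have hM0 : 0 ≤ M := by positivity
  have ht0 : 0 < c / (M + 2 * c) := by positivity
  have ht1 : c / (M + 2 * c) < 1 := by
    rw [div_lt_one (by positivity)]
    linarith
  have h1 := h _ ht0 ht1
  set t := c / (M + 2 * c) with ht
  have htM : t * (M + 2 * c) = c := by
    rw [ht]
    field_simp
  -- Dividing the inequality by `t` leaves `2 c ≤ t (g - 2 J + e)`, too large for this `t`.
  have h2 : 2 * c ≤ t * (g - 2 * J + e) := by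
    have h3 : t * (2 * c) ≤ t * (t * (g - 2 * J + e)) := by
      rw [hc]
      nlinarith
    exact le_of_mul_le_mul_left h3 ht0
  have h4 : g - 2 * J + e ≤ M := by
    have := le_abs_self g
    have := neg_abs_le J
    have := le_abs_self e
    linarith
  have h5 := mul_le_mul_of_nonneg_left h4 ht0.le
  nlinarith

/-- First variation: if moving from `ν` towards `μ` does not decrease the energy, then the
potential of `ν` has `μ`-integral at least the energy of `ν`. -/
lemma energy_le_lintegral_potential {D : ℝ} {μ ν : Measure ℂ} [SFinite μ] [SFinite ν]
    (hν : energy D ν ≠ ⊤) (hμ : energy D μ ≠ ⊤)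
    (hmin : ∀ t : ℝ, 0 < t → t < 1 →
      energy D ν ≤ energy D (ENNReal.ofReal (1 - t) • ν + ENNReal.ofReal t • μ)) :
    energy D ν ≤ ∫⁻ z, potential D ν z ∂μ := by
  by_cases hJ : ∫⁻ z, potential D ν z ∂μ = ⊤
  · rw [hJ]
    exact le_top
  rw [← ENNReal.toReal_le_toReal hν hJ]
  refine le_of_forall_convexComb_le (e := (energy D μ).toReal) fun t ht0 ht1 => ?_
  have h := hmin t ht0 ht1
  rw [energy_convexComb] at h
  have h1 := ENNReal.toReal_mono (by finiteness) h
  rw [ENNReal.toReal_add (by finiteness) (by finiteness),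
    ENNReal.toReal_add (by finiteness) (by finiteness)] at h1
  simpa [ENNReal.toReal_mul, ENNReal.toReal_ofReal ht0.le,
    ENNReal.toReal_ofReal (by linarith : 0 ≤ 1 - t)] using h1

/-! ### Cantor measures on uniformly perfect sets -/

/-- The `k`-th approximation, along the branch `ω` of the binary tree, of a point of a Cantor set:
at stage `k` the current point is either kept or replaced by its image under `σ k`. -/
def branch (σ : ℕ → ℂ → ℂ) (z : ℂ) : ℕ → (ℕ → Bool) → ℂ
  | 0, _ => z
  | k + 1, ω => if ω k then σ k (branch σ z k ω) else branch σ z k ω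

/-- The point of the Cantor set at the end of the branch `ω`. -/
noncomputable def branchLim (σ : ℕ → ℂ → ℂ) (z : ℂ) (ω : ℕ → Bool) : ℂ :=
  limUnder atTop fun k => branch σ z k ω

lemma isLocallyConstant_branch (σ : ℕ → ℂ → ℂ) (z : ℂ) (k : ℕ) :
    IsLocallyConstant (branch σ z k) := by
  induction k with
  | zero => exact IsLocallyConstant.const z
  | succ k ih =>
    have h1 : IsLocallyConstant fun ω : ℕ → Bool => ω k :=
      (IsLocallyConstant.iff_continuous _).2 (continuous_apply k)
    exact (h1.prodMk ih).comp fun p => if p.1 then σ k p.2 else p.2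

lemma branch_congr (σ : ℕ → ℂ → ℂ) (z : ℂ) {k : ℕ} {ω ω' : ℕ → Bool}
    (h : ∀ i < k, ω i = ω' i) : branch σ z k ω = branch σ z k ω' := by
  induction k with
  | zero => rfl
  | succ k ih =>
    simp only [branch]
    rw [h k (Nat.lt_succ_self k), ih fun i hi => h i (hi.trans (Nat.lt_succ_self k))]

/-- The uniform measure on the binary sequences. -/
noncomputable def coinFlips : Measure (ℕ → Bool) :=
  Measure.infinitePi fun _ => (PMF.uniformOfFintype Bool).toMeasure

instance : IsProbabilityMeasure coinFlips := by
  unfold coinFlips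
  infer_instance

lemma coinFlips_cylinder (k : ℕ) (ω₀ : ℕ → Bool) :
    coinFlips {ω | ∀ i < k, ω i = ω₀ i} = 2⁻¹ ^ k := by
  have h : {ω : ℕ → Bool | ∀ i < k, ω i = ω₀ i} =
      Set.pi (Finset.range k : Set ℕ) fun i => {ω₀ i} := by
    ext ω
    simp
  rw [h, coinFlips, Measure.infinitePi_pi _ fun i _ => measurableSet_singleton _]
  simp

section Branch

variable {σ : ℕ → ℂ → ℂ} {E : Set ℂ} {z : ℂ} {a t : ℝ}

lemma branch_mem (hσ : ∀ k, ∀ x ∈ E, σ k x ∈ E) (hz : z ∈ E) (k : ℕ) (ω : ℕ → Bool) :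
    branch σ z k ω ∈ E := by
  induction k with
  | zero => exact hz
  | succ k ih =>
    simp only [branch]
    split_ifs
    exacts [hσ k _ ih, ih]

lemma dist_branch_succ_le (ha : 0 < a) (ht : 0 < t) (hσ : ∀ k, ∀ x ∈ E, σ k x ∈ E)
    (hσt : ∀ k, ∀ x ∈ E, ‖x - σ k x‖ ≤ t * (a / 8) ^ k) (hz : z ∈ E) (ω : ℕ → Bool) (k : ℕ) :
    dist (branch σ z k ω) (branch σ z (k + 1) ω) ≤ t * (a / 8) ^ k := by
  simp only [branch]
  split_ifs
  · rw [dist_eq_norm]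
    exact hσt k _ (branch_mem hσ hz k ω)
  · rw [dist_self]
    positivity

lemma tendsto_branch (ha : 0 < a) (ha1 : a ≤ 1) (ht : 0 < t) (hσ : ∀ k, ∀ x ∈ E, σ k x ∈ E)
    (hσt : ∀ k, ∀ x ∈ E, ‖x - σ k x‖ ≤ t * (a / 8) ^ k) (hz : z ∈ E) (ω : ℕ → Bool) :
    Tendsto (fun k => branch σ z k ω) atTop (𝓝 (branchLim σ z ω)) :=
  (cauchySeq_of_le_geometric (a / 8) t (by linarith)
    (dist_branch_succ_le ha ht hσ hσt hz ω)).tendsto_limUnder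

lemma dist_branch_branchLim_le (ha : 0 < a) (ha1 : a ≤ 1) (ht : 0 < t)
    (hσ : ∀ k, ∀ x ∈ E, σ k x ∈ E)
    (hσt : ∀ k, ∀ x ∈ E, ‖x - σ k x‖ ≤ t * (a / 8) ^ k) (hz : z ∈ E) (ω : ℕ → Bool) (k : ℕ) :
    dist (branch σ z k ω) (branchLim σ z ω) ≤ 2 * (t * (a / 8) ^ k) := by
  have h := dist_le_of_le_geometric_of_tendsto (a / 8) t (by linarith)
    (dist_branch_succ_le ha ht hσ hσt hz ω) (tendsto_branch ha ha1 ht hσ hσt hz ω) k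
  refine h.trans ?_
  have : 0 < t * (a / 8) ^ k := by positivity
  rw [div_le_iff₀ (by linarith)]
  nlinarith

/-- Branches that separate at stage `k` end at points at distance at least `(a / 2) t (a / 8) ^ k`:
the later displacements are too small to make up for the separation. -/
lemma le_dist_branchLim (ha : 0 < a) (ha1 : a ≤ 1) (ht : 0 < t) (hσ : ∀ k, ∀ x ∈ E, σ k x ∈ E)
    (hσt : ∀ k, ∀ x ∈ E, ‖x - σ k x‖ ≤ t * (a / 8) ^ k)
    (hσa : ∀ k, ∀ x ∈ E, a * (t * (a / 8) ^ k) ≤ ‖x - σ k x‖) (hz : z ∈ E)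
    {ω ω' : ℕ → Bool} {k : ℕ} (hlt : ∀ i < k, ω i = ω' i) (hk : ω k ≠ ω' k) :
    a / 2 * (t * (a / 8) ^ k) ≤ dist (branchLim σ z ω) (branchLim σ z ω') := by
  have h1 := dist_branch_branchLim_le ha ha1 ht hσ hσt hz ω (k + 1)
  have h2 := dist_branch_branchLim_le ha ha1 ht hσ hσt hz ω' (k + 1)
  have h3 : a * (t * (a / 8) ^ k) ≤ dist (branch σ z (k + 1) ω) (branch σ z (k + 1) ω') := by
    have h4 := hσa k _ (branch_mem hσ hz k ω)
    simp only [branch]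
    rw [← branch_congr σ z hlt]
    cases h5 : ω k <;> cases h6 : ω' k <;> simp_all [dist_eq_norm, norm_sub_rev]
  have h7 := dist_triangle4 (branch σ z (k + 1) ω) (branchLim σ z ω) (branchLim σ z ω')
    (branch σ z (k + 1) ω')
  rw [dist_comm (branchLim σ z ω')] at h7
  rw [pow_succ] at h1 h2
  nlinarith

lemma measurable_branchLim (ha : 0 < a) (ha1 : a ≤ 1) (ht : 0 < t)
    (hσ : ∀ k, ∀ x ∈ E, σ k x ∈ E)
    (hσt : ∀ k, ∀ x ∈ E, ‖x - σ k x‖ ≤ t * (a / 8) ^ k) (hz : z ∈ E) :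
    Measurable (branchLim σ z) :=
  measurable_of_tendsto_metrizable
    (fun k => (isLocallyConstant_branch σ z k).continuous.measurable)
    (tendsto_pi_nhds.2 fun ω => tendsto_branch ha ha1 ht hσ hσt hz ω)

/-- Branches whose end points are close to a common point agree on an initial segment, so that
the Cantor measure of a disc of radius `(a / 4) t (a / 8) ^ k` is at most `2 ^ (-k)`. -/
lemma coinFlips_branchLim_ball_le (ha : 0 < a) (ha1 : a ≤ 1) (ht : 0 < t)
    (hσ : ∀ k, ∀ x ∈ E, σ k x ∈ E)
    (hσt : ∀ k, ∀ x ∈ E, ‖x - σ k x‖ ≤ t * (a / 8) ^ k)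
    (hσa : ∀ k, ∀ x ∈ E, a * (t * (a / 8) ^ k) ≤ ‖x - σ k x‖) (hz : z ∈ E) (x : ℂ) (k : ℕ) :
    coinFlips {ω | ‖x - branchLim σ z ω‖ < a / 4 * (t * (a / 8) ^ k)} ≤ 2⁻¹ ^ k := by
  rcases Set.eq_empty_or_nonempty {ω | ‖x - branchLim σ z ω‖ < a / 4 * (t * (a / 8) ^ k)} with
    h | ⟨ω₀, h₀⟩
  · simp [h]
  rw [← coinFlips_cylinder k ω₀]
  refine measure_mono fun ω hω i hi => ?_
  by_contra hne
  have hex : ∃ i, ω i ≠ ω₀ i := ⟨i, hne⟩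
  classical
  have hmin := fun j hj => not_not.1 (Nat.find_min hex (m := j) hj)
  have h1 := le_dist_branchLim ha ha1 ht hσ hσt hσa hz hmin (Nat.find_spec hex)
  have h2 : Nat.find hex ≤ k := (Nat.find_min' hex hne).trans hi.le
  have h3 : (a / 8) ^ k ≤ (a / 8) ^ Nat.find hex :=
    pow_le_pow_of_le_one (by positivity) (by linarith) h2
  have h4 : dist (branchLim σ z ω) (branchLim σ z ω₀) < a / 2 * (t * (a / 8) ^ k) := by
    have h5 := dist_triangle_left (branchLim σ z ω) (branchLim σ z ω₀) x
    simp only [Set.mem_ofPred_eq, dist_eq_norm] at hω h₀ h5 ⊢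
    linarith
  have h6 : a / 2 * (t * (a / 8) ^ k) ≤ a / 2 * (t * (a / 8) ^ Nat.find hex) := by gcongr
  linarith

end Branch

/-- The layer-cake bound for the kernel: it exceeds `log (D / c)` by at most `log b⁻¹` for each
`k` such that `w` lies in the disc of radius `c b ^ k` about `x`. -/
lemma logKernel_le_tsum {D c b : ℝ} (hD : 0 < D) (hc : 0 < c) (hb : 0 < b) (hb1 : b < 1)
    (x w : ℂ) :
    logKernel D x w ≤ ENNReal.ofReal (Real.log (D / c)) +
      ∑' k : ℕ, {y : ℂ | ‖x - y‖ < c * b ^ k}.indicator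
        (fun _ => ENNReal.ofReal (Real.log b⁻¹)) w := by
  have hlog : 0 < Real.log b⁻¹ := Real.log_pos ((one_lt_inv₀ hb).2 hb1)
  by_cases hex : ∃ k : ℕ, c * b ^ k ≤ ‖x - w‖
  · classical
    set k := Nat.find hex with hk
    have h1 : c * b ^ k ≤ ‖x - w‖ := Nat.find_spec hex
    have h2 : ∀ j < k, ‖x - w‖ < c * b ^ j := fun j hj => not_le.1 (Nat.find_min hex hj)
    refine (logKernel_le hD (by positivity) h1).trans ?_
    have h3 : Real.log (D / (c * b ^ k)) = Real.log (D / c) + k * Real.log b⁻¹ := by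
      rw [← div_div, Real.log_div (by positivity) (by positivity), Real.log_pow, Real.log_inv]
      ring
    rw [h3]
    refine ENNReal.ofReal_add_le.trans ?_
    gcongr
    calc ENNReal.ofReal (k * Real.log b⁻¹)
        = ∑ j ∈ Finset.range k, {y : ℂ | ‖x - y‖ < c * b ^ j}.indicator
            (fun _ => ENNReal.ofReal (Real.log b⁻¹)) w := by
          rw [Finset.sum_congr rfl (g := fun _ => ENNReal.ofReal (Real.log b⁻¹)) fun j hj =>
            Set.indicator_of_mem (show w ∈ {y : ℂ | ‖x - y‖ < c * b ^ j} from
              h2 j (Finset.mem_range.1 hj)) _]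
          rw [Finset.sum_const, Finset.card_range, nsmul_eq_mul, ENNReal.ofReal_mul (by positivity),
            ENNReal.ofReal_natCast]
      _ ≤ _ := ENNReal.sum_le_tsum _
  · push Not at hex
    have h1 : ∀ k : ℕ, {y : ℂ | ‖x - y‖ < c * b ^ k}.indicator
        (fun _ => ENNReal.ofReal (Real.log b⁻¹)) w = ENNReal.ofReal (Real.log b⁻¹) :=
      fun k =>
      Set.indicator_of_mem (show w ∈ {y : ℂ | ‖x - y‖ < c * b ^ k} from hex k) _
    simp_rw [h1]
    rw [ENNReal.tsum_const_eq_top_of_ne_zero (by simpa using hlog)]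
    simp

/-- In a uniformly perfect set every disc about a point of the set carries a probability measure
whose potential is bounded, on the whole plane and up to a constant that depends only on the
uniform perfectness, by that of a point mass seen from the distance of the radius. -/
lemma exists_measure_potential_le {E : Set ℂ} {a d D : ℝ} (hE : IsClosed E) (hD : 0 < D)
    (ha : 0 < a) (ha1 : a ≤ 1)
    (hup : ∀ z ∈ E, ∀ r : ℝ, 0 < r → r < d → ∃ w ∈ E, a * r ≤ ‖z - w‖ ∧ ‖z - w‖ ≤ r)
    {z : ℂ} (hz : z ∈ E) {r : ℝ} (hr : 0 < r) (hrd : r < d) :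
    ∃ μ : Measure ℂ, IsProbabilityMeasure μ ∧ (∀ᵐ w ∂μ, w ∈ E ∧ ‖z - w‖ ≤ r) ∧
      ∀ x, potential D μ x ≤ ENNReal.ofReal (Real.log (D / r)) +
        ENNReal.ofReal (3 * Real.log (8 / a)) := by
  set t := r / 2 with ht_def
  have ht : 0 < t := by positivity
  have hex : ∀ (k : ℕ) (x : ℂ), ∃ y : ℂ, x ∈ E →
      y ∈ E ∧ a * (t * (a / 8) ^ k) ≤ ‖x - y‖ ∧ ‖x - y‖ ≤ t * (a / 8) ^ k := by
    intro k x
    by_cases hx : x ∈ E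
    · have h1 : (a / 8) ^ k ≤ 1 := pow_le_one₀ (by positivity) (by linarith)
      have h2 : t * (a / 8) ^ k ≤ t := by nlinarith
      obtain ⟨w, hw⟩ := hup x hx (t * (a / 8) ^ k) (by positivity) (by linarith)
      exact ⟨w, fun _ => hw⟩
    · exact ⟨0, fun h => absurd h hx⟩
  choose σ hσ using hex
  have hσE : ∀ k, ∀ x ∈ E, σ k x ∈ E := fun k x hx => (hσ k x hx).1
  have hσa := fun k x hx => (hσ k x hx).2.1
  have hσt := fun k x hx => (hσ k x hx).2.2
  have hm := measurable_branchLim ha ha1 ht hσE hσt hz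
  refine ⟨coinFlips.map (branchLim σ z), Measure.isProbabilityMeasure_map hm.aemeasurable, ?_, ?_⟩
  · have hset : MeasurableSet {w : ℂ | w ∈ E ∧ ‖z - w‖ ≤ r} :=
      hE.measurableSet.inter
        (measurableSet_le (f := fun w : ℂ => ‖z - w‖) (by fun_prop) measurable_const)
    rw [ae_map_iff hm.aemeasurable hset]
    refine Eventually.of_forall fun ω => ⟨?_, ?_⟩
    · exact hE.mem_of_tendsto (tendsto_branch ha ha1 ht hσE hσt hz ω)
        (Eventually.of_forall fun k => branch_mem hσE hz k ω)
    · have h := dist_branch_branchLim_le ha ha1 ht hσE hσt hz ω 0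
      rw [dist_eq_norm] at h
      simp only [branch, pow_zero, mul_one] at h
      linarith
  · intro x
    have hlog : Real.log (a / 8)⁻¹ = Real.log (8 / a) := by rw [inv_div]
    have hlog0 : 0 ≤ Real.log (8 / a) := Real.log_nonneg (by rw [le_div_iff₀ ha]; linarith)
    have hmeas : ∀ k : ℕ, MeasurableSet {y : ℂ | ‖x - y‖ < a / 4 * t * (a / 8) ^ k} :=
      fun k => measurableSet_lt (by fun_prop) measurable_const
    calc potential D (coinFlips.map (branchLim σ z)) x
        ≤ ∫⁻ w, (ENNReal.ofReal (Real.log (D / (a / 4 * t))) +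
            ∑' k : ℕ, {y : ℂ | ‖x - y‖ < a / 4 * t * (a / 8) ^ k}.indicator
              (fun _ => ENNReal.ofReal (Real.log (a / 8)⁻¹)) w)
              ∂(coinFlips.map (branchLim σ z)) :=
          lintegral_mono fun w =>
            logKernel_le_tsum hD (by positivity) (by positivity) (by linarith) x w
      _ = ENNReal.ofReal (Real.log (D / (a / 4 * t))) +
            ∑' k : ℕ, ENNReal.ofReal (Real.log (8 / a)) *
              coinFlips {ω | ‖x - branchLim σ z ω‖ < a / 4 * (t * (a / 8) ^ k)} := by
          have : IsProbabilityMeasure (coinFlips.map (branchLim σ z)) :=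
            Measure.isProbabilityMeasure_map hm.aemeasurable
          rw [lintegral_add_left measurable_const, lintegral_const, measure_univ, mul_one,
            lintegral_tsum fun k => (measurable_const.indicator (hmeas k)).aemeasurable]
          congr 2
          ext k
          rw [lintegral_indicator_const (hmeas k), Measure.map_apply hm (hmeas k), hlog]
          simp only [Set.preimage_ofPred_eq, mul_assoc]
      _ ≤ ENNReal.ofReal (Real.log (D / (a / 4 * t))) +
            ∑' k : ℕ, ENNReal.ofReal (Real.log (8 / a)) * 2⁻¹ ^ k := by
          gcongr with k
          exact coinFlips_branchLim_ball_le ha ha1 ht hσE hσt hσa hz x k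
      _ = ENNReal.ofReal (Real.log (D / (a / 4 * t))) +
            ENNReal.ofReal (Real.log (8 / a)) * 2 := by
          rw [ENNReal.tsum_mul_left, ENNReal.tsum_geometric, ENNReal.one_sub_inv_two, inv_inv]
      _ = ENNReal.ofReal (Real.log (D / r) + Real.log (8 / a)) +
            ENNReal.ofReal (2 * Real.log (8 / a)) := by
          congr 2
          · rw [← Real.log_mul (by positivity) (by positivity), ht_def]
            congr 1
            field_simp
            norm_num
          · rw [mul_comm, ENNReal.ofReal_mul (by norm_num)]
            simp
      _ ≤ _ := by
          refine (add_le_add_left ENNReal.ofReal_add_le _).trans_eq ?_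
          rw [add_assoc, ← ENNReal.ofReal_add hlog0 (by positivity)]
          congr 2
          ring

section

variable {D : ℝ} {E S : Set ℂ} {ν : Measure ℂ}

/-! ### Regularity of the points of a uniformly perfect set -/

lemma measure_singleton_eq_zero_of_potential_ne_top (hD : 0 < D) {z : ℂ}
    (h : potential D ν z ≠ ⊤) : ν {z} = 0 := by
  by_contra hne
  refine h (top_le_iff.1 ?_)
  calc (⊤ : ℝ≥0∞) = logKernel D z z * ν {z} := by
        rw [logKernel_self hD, ENNReal.top_mul hne]
    _ = ∫⁻ w in {z}, logKernel D z w ∂ν := by simp [mul_comm]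
    _ ≤ potential D ν z := setLIntegral_le_lintegral _ _

lemma exists_closedBall_measure_lt [IsFiniteMeasure ν] {z : ℂ} (hz : ν {z} = 0) {ε : ℝ≥0∞}
    (hε : 0 < ε) : ∃ ρ : ℝ, 0 < ρ ∧ ν (Metric.closedBall z ρ) < ε := by
  have h := tendsto_measure_cthickening_of_isClosed (μ := ν) (s := {z})
    ⟨1, one_pos, measure_ne_top _ _⟩ isClosed_singleton
  rw [hz] at h
  have h1 : ∀ᶠ ρ in 𝓝[>] (0 : ℝ), ν (Metric.cthickening ρ {z}) < ε :=
    (h.mono_left nhdsWithin_le_nhds).eventually (gt_mem_nhds hε)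
  obtain ⟨ρ, h2, h3⟩ := (h1.and self_mem_nhdsWithin).exists
  refine ⟨ρ, h3, ?_⟩
  rwa [Metric.cthickening_singleton z (le_of_lt h3)] at h2

lemma lintegral_le_of_near_far [IsProbabilityMeasure ν] {f g : ℂ → ℝ≥0∞} {B : Set ℂ}
    {A ε : ℝ≥0∞} (hg : Measurable g) (hB : MeasurableSet B)
    (hnear : ∀ᵐ w ∂ν, f w ≤ g w + A) (hfar : ∀ᵐ w ∂ν, w ∉ B → f w ≤ g w + ε) :
    ∫⁻ w, f w ∂ν ≤ ∫⁻ w, g w ∂ν + (A * ν B + ε) := by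
  calc ∫⁻ w, f w ∂ν ≤ ∫⁻ w, (g w + (B.indicator (fun _ => A) w + ε)) ∂ν := by
        refine lintegral_mono_ae ?_
        filter_upwards [hnear, hfar] with w h1 h2
        by_cases hw : w ∈ B
        · rw [Set.indicator_of_mem hw]
          refine h1.trans ?_
          gcongr
          exact le_self_add
        · rw [Set.indicator_of_notMem hw, zero_add]
          exact h2 hw
    _ = _ := by
        rw [lintegral_add_left hg, lintegral_add_left (measurable_const.indicator hB),
          lintegral_indicator_const hB]
        simp

/-- The potential of a measure at a point of a uniformly perfect set is at least its energy, as
soon as the measure satisfies the variational inequality there. The inequality is tested on Cantor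
measures that concentrate at the point: by the symmetry of the kernel their potentials are
integrated against `ν`, and they converge to the kernel at the point in a dominated way. -/
lemma energy_le_potential {a d : ℝ} [IsProbabilityMeasure ν] (hE : IsClosed E) (hD : 0 < D)
    (ha : 0 < a) (ha1 : a ≤ 1) (hd : 0 < d)
    (hup : ∀ z ∈ E, ∀ r : ℝ, 0 < r → r < d → ∃ w ∈ E, a * r ≤ ‖z - w‖ ∧ ‖z - w‖ ≤ r)
    (hvar : ∀ μ : Measure ℂ, IsProbabilityMeasure μ → μ Eᶜ = 0 → energy D μ ≠ ⊤ →
      energy D ν ≤ ∫⁻ z, potential D ν z ∂μ)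
    {z : ℂ} (hz : z ∈ E) : energy D ν ≤ potential D ν z := by
  by_cases hV : potential D ν z = ⊤
  · rw [hV]
    exact le_top
  have hz0 := measure_singleton_eq_zero_of_potential_ne_top hD hV
  refine ENNReal.le_of_forall_pos_le_add fun ε hε _ => ?_
  set A : ℝ≥0∞ := ENNReal.ofReal (Real.log 2) + ENNReal.ofReal (3 * Real.log (8 / a)) with hA
  have hA0 : A ≠ 0 := by
    have : 0 < Real.log 2 := Real.log_pos (by norm_num)
    simp [hA, this]
  have hAt : A ≠ ⊤ := by finiteness
  obtain ⟨ρ, hρ, hνρ⟩ := exists_closedBall_measure_lt (ν := ν) (z := z) hz0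
    (ε := (ε / 2 : ℝ≥0) / A) (ENNReal.div_pos (by simpa using hε.ne') hAt)
  set c := Real.exp (ε / 2) with hc
  have hc1 : 1 < c := Real.one_lt_exp_iff.2 (by positivity)
  have hlogc : ENNReal.ofReal (Real.log c) = (ε / 2 : ℝ≥0) := by
    rw [hc, Real.log_exp, ← ENNReal.ofReal_coe_nnreal]
    simp
  obtain ⟨r, hr, hrd, hrρ, hrc⟩ : ∃ r : ℝ, 0 < r ∧ r < d ∧ 2 * r ≤ ρ ∧ r * c ≤ (c - 1) * ρ := by
    refine ⟨min (d / 2) (min (ρ / 2) ((c - 1) * ρ / c)), ?_, ?_, ?_, ?_⟩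
    · have : 0 < (c - 1) * ρ / c := by
        have : 0 < c - 1 := by linarith
        positivity
      positivity
    · exact (min_le_left _ _).trans_lt (by linarith)
    · have := (min_le_right (d / 2) _).trans (min_le_left (ρ / 2) ((c - 1) * ρ / c))
      linarith
    · have := (min_le_right (d / 2) _).trans (min_le_right (ρ / 2) ((c - 1) * ρ / c))
      rwa [le_div_iff₀ (by linarith)] at this
  obtain ⟨μ, hμ, hμE, hμV⟩ := exists_measure_potential_le hE hD ha ha1 hup hz hr hrd
  have hμfin : energy D μ ≠ ⊤ := by
    have : energy D μ ≤ ∫⁻ x, (ENNReal.ofReal (Real.log (D / r)) +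
        ENNReal.ofReal (3 * Real.log (8 / a))) ∂μ := lintegral_mono fun x => hμV x
    refine (this.trans_lt ?_).ne
    rw [lintegral_const]
    finiteness
  have h1 := hvar μ hμ (by
    have : ∀ᵐ w ∂μ, w ∈ E := hμE.mono fun w hw => hw.1
    exact this) hμfin
  rw [lintegral_potential_comm] at h1
  have hcomp : ∀ w : ℂ, ∀ b : ℝ, 0 < b → (∀ y, ‖z - y‖ ≤ r → ‖z - w‖ ≤ b * ‖y - w‖) →
      potential D μ w ≤ logKernel D z w + ENNReal.ofReal (Real.log b) := by
    intro w b hb h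
    calc potential D μ w ≤ ∫⁻ y, (logKernel D z w + ENNReal.ofReal (Real.log b)) ∂μ := by
          refine lintegral_mono_ae ?_
          filter_upwards [hμE] with y hy
          rw [logKernel_comm D w y]
          exact logKernel_le_add hD hb (h y hy.2)
      _ = _ := by simp
  have h2 := lintegral_le_of_near_far (ν := ν) (f := potential D μ) (g := logKernel D z)
    (B := Metric.closedBall z ρ) (A := A) (ε := (ε / 2 : ℝ≥0))
    (continuous_logKernel_right D z).measurable Metric.isClosed_closedBall.measurableSet
    (Eventually.of_forall fun w => by
      rcases le_total (2 * r) ‖z - w‖ with h | h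
      · refine (hcomp w 2 two_pos fun y hy => ?_).trans ?_
        · have := norm_sub_le_norm_sub_add_norm_sub z y w
          linarith
        · gcongr
          exact le_self_add
      · refine (hμV w).trans ?_
        rw [hA, ← add_assoc]
        gcongr
        calc ENNReal.ofReal (Real.log (D / r))
            = ENNReal.ofReal (Real.log (D / (2 * r)) + Real.log 2) := by
              rw [← Real.log_mul (by positivity) (by norm_num)]
              congr 2
              field_simp
          _ ≤ _ := ENNReal.ofReal_add_le
          _ ≤ _ := by
              gcongr
              exact le_logKernel hD h)
    (Eventually.of_forall fun w hw => by
      rw [← hlogc]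
      refine hcomp w c (by linarith) fun y hy => ?_
      rw [Metric.mem_closedBall', dist_eq_norm, not_le] at hw
      have := norm_sub_le_norm_sub_add_norm_sub z y w
      nlinarith)
  refine h1.trans (h2.trans ?_)
  change potential D ν z + _ ≤ _
  gcongr
  calc A * ν (Metric.closedBall z ρ) + (ε / 2 : ℝ≥0)
      ≤ A * ((ε / 2 : ℝ≥0) / A) + (ε / 2 : ℝ≥0) := by gcongr
    _ = ε := by
        rw [ENNReal.mul_div_cancel hA0 hAt, ← ENNReal.coe_add, add_halves]

/-! ### Continuity of the potential and the maximum principle -/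

lemma exists_pos_forall_le_norm_sub (hS : IsClosed S) {z : ℂ} (hz : z ∉ S) :
    ∃ ρ : ℝ, 0 < ρ ∧ ∀ w ∈ S, ρ ≤ ‖z - w‖ := by
  obtain ⟨ρ, hρ, hball⟩ := Metric.isOpen_iff.1 hS.isOpen_compl z hz
  refine ⟨ρ, hρ, fun w hw => ?_⟩
  by_contra h
  rw [← dist_eq_norm, not_le, dist_comm] at h
  exact hball (Metric.mem_ball.2 h) hw

lemma continuousAt_potential_of_notMem [IsFiniteMeasure ν] (hD : 0 < D) (hS : IsClosed S)
    (hν : ∀ᵐ w ∂ν, w ∈ S) {z : ℂ} (hz : z ∉ S) : ContinuousAt (potential D ν) z := by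
  obtain ⟨ρ, hρ, hρS⟩ := exists_pos_forall_le_norm_sub hS hz
  refine tendsto_lintegral_filter_of_dominated_convergence
    (fun _ => ENNReal.ofReal (Real.log (D / (ρ / 2))))
    (Eventually.of_forall fun z => (continuous_logKernel_right D z).measurable) ?_ ?_
    (Eventually.of_forall fun w => (continuous_logKernel_left D w).tendsto z)
  · filter_upwards [Metric.ball_mem_nhds z (half_pos hρ)] with z' hz'
    filter_upwards [hν] with w hw
    refine logKernel_le hD (half_pos hρ) ?_
    have h1 := hρS w hw
    rw [Metric.mem_ball', dist_eq_norm] at hz'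
    have h2 := norm_sub_le_norm_sub_add_norm_sub z z' w
    linarith
  · rw [lintegral_const]
    finiteness

lemma potential_ne_top_of_notMem [IsFiniteMeasure ν] (hD : 0 < D) (hS : IsClosed S)
    (hν : ∀ᵐ w ∂ν, w ∈ S) {z : ℂ} (hz : z ∉ S) : potential D ν z ≠ ⊤ := by
  obtain ⟨ρ, hρ, hρS⟩ := exists_pos_forall_le_norm_sub hS hz
  have : potential D ν z ≤ ∫⁻ _, ENNReal.ofReal (Real.log (D / ρ)) ∂ν := by
    refine lintegral_mono_ae ?_
    filter_upwards [hν] with w hw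
    exact logKernel_le hD hρ (hρS w hw)
  refine (this.trans_lt ?_).ne
  rw [lintegral_const]
  finiteness

/-- The continuity principle: a bound for the potential on a closed set that carries the measure
persists, up to `ε`, near the points of that set. The potential at `z` is compared with the one at
a point of the set nearest to `z`. -/
lemma eventually_potential_le [IsProbabilityMeasure ν] (hD : 0 < D) (hS : IsClosed S)
    (hν : ∀ᵐ w ∂ν, w ∈ S) {γ : ℝ≥0∞} (hγ : γ ≠ ⊤) (hSγ : ∀ z ∈ S, potential D ν z ≤ γ)
    {z₀ : ℂ} (hz₀ : z₀ ∈ S) {ε : ℝ≥0} (hε : 0 < ε) :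
    ∀ᶠ z in 𝓝 z₀, potential D ν z ≤ γ + ε := by
  have hz0 := measure_singleton_eq_zero_of_potential_ne_top hD
    (ne_top_of_le_ne_top hγ (hSγ z₀ hz₀))
  set A : ℝ≥0∞ := ENNReal.ofReal (Real.log 2) with hA
  have hA0 : A ≠ 0 := by
    have : 0 < Real.log 2 := Real.log_pos (by norm_num)
    simp [hA, this]
  have hAt : A ≠ ⊤ := by finiteness
  obtain ⟨ρ, hρ, hνρ⟩ := exists_closedBall_measure_lt (ν := ν) (z := z₀) hz0
    (ε := (ε / 2 : ℝ≥0) / A) (ENNReal.div_pos (by simpa using hε.ne') hAt)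
  set c := Real.exp (ε / 2) with hc
  have hc1 : 1 < c := Real.one_lt_exp_iff.2 (by positivity)
  have hlogc : ENNReal.ofReal (Real.log c) = (ε / 2 : ℝ≥0) := by
    rw [hc, Real.log_exp, ← ENNReal.ofReal_coe_nnreal]
    simp
  have hδ : 0 < (c - 1) * ρ / c := by
    have : 0 < c - 1 := by linarith
    positivity
  filter_upwards [Metric.ball_mem_nhds z₀ hδ] with z hz
  rw [Metric.mem_ball, lt_div_iff₀ (by linarith)] at hz
  obtain ⟨ζ, hζ, hζz⟩ := hS.exists_infDist_eq_dist ⟨z₀, hz₀⟩ z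
  have hnearest : ∀ w ∈ S, ‖z - ζ‖ ≤ ‖z - w‖ := by
    intro w hw
    rw [← dist_eq_norm, ← dist_eq_norm, ← hζz]
    exact Metric.infDist_le_dist_of_mem hw
  have h := lintegral_le_of_near_far (ν := ν) (f := logKernel D z) (g := logKernel D ζ)
    (B := Metric.closedBall z₀ ρ) (A := A) (ε := (ε / 2 : ℝ≥0))
    (continuous_logKernel_right D ζ).measurable Metric.isClosed_closedBall.measurableSet
    (by
      filter_upwards [hν] with w hw
      refine logKernel_le_add hD two_pos ?_
      have h1 := norm_sub_le_norm_sub_add_norm_sub ζ z w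
      rw [norm_sub_rev ζ z] at h1
      have h2 := hnearest w hw
      linarith)
    (by
      filter_upwards [hν] with w hw hwB
      rw [← hlogc]
      refine logKernel_le_add hD (by linarith) ?_
      rw [Metric.mem_closedBall', dist_eq_norm, not_le] at hwB
      rw [dist_eq_norm] at hz
      have h1 := norm_sub_le_norm_sub_add_norm_sub ζ z w
      rw [norm_sub_rev ζ z] at h1
      have h2 := hnearest z₀ hz₀
      have h3 := norm_sub_le_norm_sub_add_norm_sub z₀ z w
      rw [norm_sub_rev z₀ z] at h3
      nlinarith)
  refine h.trans (add_le_add (hSγ ζ hζ) ?_)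
  calc A * ν (Metric.closedBall z₀ ρ) + (ε / 2 : ℝ≥0)
      ≤ A * ((ε / 2 : ℝ≥0) / A) + (ε / 2 : ℝ≥0) := by gcongr
    _ = ε := by
        rw [ENNReal.mul_div_cancel hA0 hAt, ← ENNReal.coe_add, add_halves]

lemma continuous_potential [IsProbabilityMeasure ν] (hD : 0 < D) (hS : IsClosed S)
    (hν : ∀ᵐ w ∂ν, w ∈ S) {γ : ℝ≥0∞} (hγ : γ ≠ ⊤) (hSγ : ∀ z ∈ S, potential D ν z = γ) :
    Continuous (potential D ν) := by
  rw [continuous_iff_lower_upperSemicontinuous]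
  refine ⟨lowerSemicontinuous_potential D ν, fun z => ?_⟩
  by_cases hz : z ∈ S
  · intro y hy
    rw [hSγ z hz] at hy
    obtain ⟨ε, hε, hεy⟩ := ENNReal.lt_iff_exists_add_pos_lt.1 hy
    exact (eventually_potential_le hD hS hν hγ (fun z hz => (hSγ z hz).le) hz hε).mono
      fun x hx => hx.trans_lt hεy
  · exact (continuousAt_potential_of_notMem hD hS hν hz).upperSemicontinuousAt

/-- The mean value property of the kernel on circles inside the domain where it is harmonic. -/
lemma lintegral_logKernel_circleMap (hD : 0 < D) {z w : ℂ} {ρ : ℝ} (hρ : 0 < ρ)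
    (hw : w ∉ Metric.closedBall z ρ) (hwD : ‖z - w‖ + ρ ≤ D) :
    ∫⁻ θ in Set.Icc 0 (2 * Real.pi), logKernel D (circleMap z ρ θ) w =
      ENNReal.ofReal (2 * Real.pi) * logKernel D z w := by
  have hne : ∀ u ∈ Metric.closedBall z ρ, u - w ≠ 0 := by
    intro u hu h
    rw [sub_eq_zero] at h
    exact hw (h ▸ hu)
  have hmem : ∀ θ, circleMap z ρ θ ∈ Metric.closedBall z ρ := circleMap_mem_closedBall z hρ.le
  have hzne : z ≠ w := sub_ne_zero.1 (hne z (Metric.mem_closedBall_self hρ.le))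
  have havg : Real.circleAverage (fun u => Real.log ‖u - w‖) z ρ = Real.log ‖z - w‖ :=
    AnalyticOnNhd.circleAverage_log_norm_of_ne_zero (g := fun u => u - w)
      (fun u _ => by fun_prop) (by rwa [abs_of_pos hρ])
  have hpi : 0 < 2 * Real.pi := by positivity
  have hint : ∫ θ in (0 : ℝ)..2 * Real.pi, Real.log ‖circleMap z ρ θ - w‖ =
      2 * Real.pi * Real.log ‖z - w‖ := by
    rw [← havg, Real.circleAverage, smul_eq_mul, mul_inv_cancel_left₀ hpi.ne']
  have hcont : Continuous fun θ => Real.log ‖circleMap z ρ θ - w‖ :=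
    Continuous.log (by fun_prop) fun θ => norm_ne_zero_iff.2 (hne _ (hmem θ))
  have hint' : ∫ θ in Set.Icc 0 (2 * Real.pi), (Real.log D - Real.log ‖circleMap z ρ θ - w‖) =
      2 * Real.pi * (Real.log D - Real.log ‖z - w‖) := by
    rw [integral_Icc_eq_integral_Ioc, ← intervalIntegral.integral_of_le hpi.le,
      intervalIntegral.integral_sub (by simp) (hcont.intervalIntegrable _ _), hint]
    simp
    ring
  have hK : ∀ θ, logKernel D (circleMap z ρ θ) w =
      ENNReal.ofReal (Real.log D - Real.log ‖circleMap z ρ θ - w‖) := by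
    intro θ
    rw [logKernel_of_ne hD (sub_ne_zero.1 (hne _ (hmem θ))), Real.log_div hD.ne'
      (norm_ne_zero_iff.2 (hne _ (hmem θ)))]
  simp_rw [hK]
  rw [← ofReal_integral_eq_lintegral_ofReal, hint', ENNReal.ofReal_mul hpi.le,
    logKernel_of_ne hD hzne, Real.log_div hD.ne' (norm_ne_zero_iff.2 (sub_ne_zero.2 hzne))]
  · exact (continuous_const.sub hcont).integrableOn_Icc
  · refine Eventually.of_forall fun θ => ?_
    have h1 : ‖circleMap z ρ θ - w‖ ≤ D := by
      have h2 := norm_sub_le_norm_sub_add_norm_sub (circleMap z ρ θ) z w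
      have h3 := hmem θ
      rw [Metric.mem_closedBall, dist_eq_norm] at h3
      linarith
    have := Real.log_le_log (norm_pos_iff.2 (hne _ (hmem θ))) h1
    simp only [Pi.zero_apply]
    linarith

/-- The local maximum principle: where the potential is harmonic it is constant near each of its
maxima. -/
lemma potential_eq_of_forall_le [IsFiniteMeasure ν] (hD : 0 < D) (hV : Continuous (potential D ν))
    {m : ℝ≥0∞} (hm : m ≠ ⊤) (hVm : ∀ z, potential D ν z ≤ m) {z z' : ℂ}
    (hz : potential D ν z = m)
    (hν : ∀ᵐ w ∂ν, w ∉ Metric.closedBall z ‖z' - z‖ ∧ ‖z - w‖ + ‖z' - z‖ ≤ D) :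
    potential D ν z' = m := by
  rcases eq_or_ne z' z with rfl | hne
  · exact hz
  set ρ := ‖z' - z‖ with hρ_def
  have hρ : 0 < ρ := norm_pos_iff.2 (sub_ne_zero.2 hne)
  have hpi : 0 < 2 * Real.pi := by positivity
  have h1 : ∫⁻ θ in Set.Icc 0 (2 * Real.pi), potential D ν (circleMap z ρ θ) =
      ENNReal.ofReal (2 * Real.pi) * m := by
    unfold potential
    rw [lintegral_lintegral_swap]
    · rw [← hz, potential, ← lintegral_const_mul _ (continuous_logKernel_right D z).measurable]
      refine lintegral_congr_ae ?_
      filter_upwards [hν] with w hw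
      exact lintegral_logKernel_circleMap hD hρ hw.1 hw.2
    · exact ((continuous_logKernel D).comp (by fun_prop :
        Continuous fun p : ℝ × ℂ => (circleMap z ρ p.1, p.2))).measurable.aemeasurable
  have h2 : ∫⁻ _ in Set.Icc 0 (2 * Real.pi), m = ENNReal.ofReal (2 * Real.pi) * m := by
    rw [setLIntegral_const, Real.volume_Icc, sub_zero, mul_comm]
  have h3 : (fun θ => potential D ν (circleMap z ρ θ))
      =ᵐ[volume.restrict (Set.Icc 0 (2 * Real.pi))] fun _ => m := by
    refine ae_eq_of_ae_le_of_lintegral_le (Eventually.of_forall fun θ => hVm _) ?_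
      measurable_const.aemeasurable (by rw [h1, h2])
    rw [h1]
    finiteness
  have h4 := Measure.eqOn_Icc_of_ae_eq volume hpi.ne h3
    (hV.comp (continuous_circleMap z ρ)).continuousOn continuousOn_const
  have h5 : z' ∈ Metric.sphere z |ρ| := by
    rw [abs_of_pos hρ, Metric.mem_sphere, dist_eq_norm]
  rw [← image_circleMap_Ioc] at h5
  obtain ⟨θ, hθ, h6⟩ := h5
  have h7 : potential D ν (circleMap z ρ θ) = m := h4 (Set.Ioc_subset_Icc_self hθ)
  rwa [h6] at h7

end

section

variable {R : ℝ} {E S : Set ℂ} {ν : Measure ℂ}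

/-! ### The potential of the equilibrium measure -/

/-- A minimizer whose potential is at least its energy on `E` has constant potential on a closed
set that carries it. -/
lemma exists_closed_carrier {D : ℝ} [IsProbabilityMeasure ν] (hE : IsClosed E)
    (hν : ∀ᵐ w ∂ν, w ∈ E)
    (hfin : energy D ν ≠ ⊤) (hreg : ∀ z ∈ E, energy D ν ≤ potential D ν z) :
    ∃ S ⊆ E, IsClosed S ∧ (∀ᵐ w ∂ν, w ∈ S) ∧ ∀ z ∈ S, potential D ν z = energy D ν := by
  have hcl : IsClosed {z | potential D ν z ≤ energy D ν} :=
    (lowerSemicontinuous_potential D ν).isClosed_preimage (energy D ν)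
  refine ⟨E ∩ {z | potential D ν z ≤ energy D ν}, Set.inter_subset_left, hE.inter hcl, ?_,
    fun z hz => le_antisymm hz.2 (hreg z hz.1)⟩
  have h : (fun _ => energy D ν) =ᵐ[ν] potential D ν := by
    refine ae_eq_of_ae_le_of_lintegral_le (hν.mono hreg) ?_
      (measurable_potential D ν).aemeasurable ?_
    · simpa using hfin
    · simp [energy]
  filter_upwards [hν, h] with w hw hw'
  exact ⟨hw, hw'.ge⟩

lemma ofReal_log_eight_le_energy [IsProbabilityMeasure ν] (hR : 0 < R)
    (hER : E ⊆ Metric.closedBall 0 R) (hν : ∀ᵐ w ∂ν, w ∈ E) :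
    ENNReal.ofReal (Real.log 8) ≤ energy (16 * R) ν := by
  have hD : 0 < 16 * R := by positivity
  calc ENNReal.ofReal (Real.log 8)
      = ∫⁻ _, ∫⁻ _, ENNReal.ofReal (Real.log (16 * R / (2 * R))) ∂ν ∂ν := by
        rw [lintegral_const, lintegral_const, measure_univ, mul_one, mul_one]
        congr 2
        field_simp
        norm_num
    _ ≤ energy (16 * R) ν := by
        refine lintegral_mono_ae ?_
        filter_upwards [hν] with x hx
        refine lintegral_mono_ae ?_
        filter_upwards [hν] with w hw
        refine le_logKernel hD ?_
        have h := hER hw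
        have h' := hER hx
        rw [mem_closedBall_zero_iff] at h h'
        have := norm_sub_le x w
        linarith

/-- With `D = 16 R` and `E` in the disc of radius `R`, far points are at distance at least `6 R` from
`E`, so the potential there is below that of points within `2 R` of each other, while up to
`|z| = 8 R` no truncation of the kernel takes place. -/
lemma potential_lt_energy_of_far [IsProbabilityMeasure ν] (hR : 0 < R)
    (hER : E ⊆ Metric.closedBall 0 R) (hν : ∀ᵐ w ∂ν, w ∈ E) {z : ℂ} (hz : 7 * R ≤ ‖z‖) :
    potential (16 * R) ν z < energy (16 * R) ν := by
  have hD : 0 < 16 * R := by positivity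
  have h1 : potential (16 * R) ν z ≤ ENNReal.ofReal (Real.log (8 / 3)) := by
    calc potential (16 * R) ν z ≤ ∫⁻ _, ENNReal.ofReal (Real.log (16 * R / (6 * R))) ∂ν := by
          refine lintegral_mono_ae ?_
          filter_upwards [hν] with w hw
          refine logKernel_le hD (by positivity) ?_
          have h := hER hw
          rw [mem_closedBall_zero_iff] at h
          have := norm_sub_norm_le z w
          linarith
      _ = ENNReal.ofReal (Real.log (8 / 3)) := by
          rw [lintegral_const, measure_univ, mul_one]
          congr 2
          field_simp
          norm_num
  refine h1.trans_lt (lt_of_lt_of_le ?_ (ofReal_log_eight_le_energy hR hER hν))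
  rw [ENNReal.ofReal_lt_ofReal_iff (Real.log_pos (by norm_num))]
  exact Real.log_lt_log (by norm_num) (by norm_num)

lemma isOpen_setOf_potential_eq_max [IsFiniteMeasure ν] (hR : 0 < R) (hS : IsClosed S)
    (hSR : S ⊆ Metric.closedBall 0 R) (hν : ∀ᵐ w ∂ν, w ∈ S)
    (hV : Continuous (potential (16 * R) ν)) {m : ℝ≥0∞} (hm : m ≠ ⊤)
    (hVm : ∀ z, potential (16 * R) ν z ≤ m)
    (hbd : ∀ z, potential (16 * R) ν z = m → ‖z‖ ≤ 7 * R) :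
    IsOpen ({z | potential (16 * R) ν z = m} ∩ Sᶜ) := by
  rw [Metric.isOpen_iff]
  rintro z ⟨hz, hzS⟩
  obtain ⟨ρ, hρ, hball⟩ := Metric.isOpen_iff.1 hS.isOpen_compl z hzS
  refine ⟨min ρ R, lt_min hρ hR, fun z' hz' => ⟨?_, ?_⟩⟩
  · rw [Metric.mem_ball, dist_eq_norm, lt_min_iff] at hz'
    refine potential_eq_of_forall_le (by positivity) hV hm hVm hz ?_
    filter_upwards [hν] with w hw
    constructor
    · intro h
      refine hball (Metric.mem_ball.2 ?_) hw
      exact (Metric.mem_closedBall.1 h).trans_lt hz'.1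
    · have h1 := hSR hw
      rw [mem_closedBall_zero_iff] at h1
      have h2 := norm_sub_le z w
      have h3 := hbd z hz
      linarith
  · exact hball (Metric.ball_subset_ball (min_le_left _ _) hz')

/-- A measure whose potential is constant on a closed carrier has its largest potential there: a
larger maximum would be attained on a nonempty bounded set, both open and closed. -/
lemma potential_le_energy [IsProbabilityMeasure ν] (hR : 0 < R) (hS : IsClosed S)
    (hSR : S ⊆ Metric.closedBall 0 R) (hν : ∀ᵐ w ∂ν, w ∈ S) (hfin : energy (16 * R) ν ≠ ⊤)
    (hSγ : ∀ z ∈ S, potential (16 * R) ν z = energy (16 * R) ν) (z : ℂ) :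
    potential (16 * R) ν z ≤ energy (16 * R) ν := by
  by_contra! hz
  have hD : 0 < 16 * R := by positivity
  have hV := continuous_potential hD hS hν hfin hSγ
  have hbd : ∀ x, energy (16 * R) ν < potential (16 * R) ν x → ‖x‖ ≤ 7 * R := by
    intro x hx
    by_contra! h
    exact absurd (potential_lt_energy_of_far hR hSR hν h.le) (not_lt.2 hx.le)
  have hcomp : IsCompact {x | potential (16 * R) ν z ≤ potential (16 * R) ν x} := by
    refine (isCompact_closedBall (0 : ℂ) (7 * R)).of_isClosed_subset
      (isClosed_le continuous_const hV) fun x hx => ?_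
    rw [mem_closedBall_zero_iff]
    exact hbd x (lt_of_lt_of_le hz hx)
  obtain ⟨x, hx, hmax⟩ := hcomp.exists_isMaxOn ⟨z, le_refl (potential (16 * R) ν z)⟩ hV.continuousOn
  set m := potential (16 * R) ν x with hm
  have hγm : energy (16 * R) ν < m := lt_of_lt_of_le hz hx
  have hVm : ∀ y, potential (16 * R) ν y ≤ m := by
    intro y
    by_cases hy : potential (16 * R) ν z ≤ potential (16 * R) ν y
    · exact hmax hy
    · exact (not_le.1 hy).le.trans hx
  have hdisj : ∀ y, potential (16 * R) ν y = m → y ∉ S := fun y hy hyS =>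
    hγm.ne ((hSγ y hyS).symm.trans hy)
  have hmtop : m ≠ ⊤ := potential_ne_top_of_notMem hD hS hν (hdisj x rfl)
  have hopen := isOpen_setOf_potential_eq_max hR hS hSR hν hV hmtop hVm
    fun y hy => hbd y (by rwa [hy])
  rw [Set.inter_eq_left.2 (show {y | potential (16 * R) ν y = m} ⊆ Sᶜ from fun y hy =>
    hdisj y hy)] at hopen
  have huniv := IsClopen.eq_univ ⟨isClosed_eq hV continuous_const, hopen⟩ ⟨x, rfl⟩
  have hfar : potential (16 * R) ν ((7 * R : ℝ) : ℂ) < energy (16 * R) ν :=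
    potential_lt_energy_of_far hR hSR hν (by
      rw [Complex.norm_real]
      exact le_abs_self _)
  have heq : potential (16 * R) ν ((7 * R : ℝ) : ℂ) = m := by
    have : ((7 * R : ℝ) : ℂ) ∈ {y | potential (16 * R) ν y = m} := huniv ▸ Set.mem_univ _
    exact this
  exact absurd hγm (not_lt.2 (heq ▸ hfar.le))

/-- Outside a compact set with connected complement the potential is strictly below its maximum:
the set where it equals the maximum is open, its complement is open and contains all far points. -/
lemma potential_lt_energy_of_notMem [IsProbabilityMeasure ν] (hR : 0 < R) (hE : IsClosed E)
    (hEc : IsPreconnected Eᶜ) (hER : E ⊆ Metric.closedBall 0 R) (hS : IsClosed S) (hSE : S ⊆ E)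
    (hν : ∀ᵐ w ∂ν, w ∈ S) (hfin : energy (16 * R) ν ≠ ⊤)
    (hSγ : ∀ z ∈ S, potential (16 * R) ν z = energy (16 * R) ν) {z : ℂ} (hz : z ∉ E) :
    potential (16 * R) ν z < energy (16 * R) ν := by
  have hD : 0 < 16 * R := by positivity
  have hSR := hSE.trans hER
  have hV := continuous_potential hD hS hν hfin hSγ
  have hle := potential_le_energy hR hS hSR hν hfin hSγ
  have hopen := isOpen_setOf_potential_eq_max hR hS hSR hν hV hfin hle fun y hy => by
    by_contra! h
    exact absurd hy (potential_lt_energy_of_far hR hSR hν h.le).ne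
  have hopen' := hopen.inter hE.isOpen_compl
  refine IsPreconnected.subset_left_of_subset_union (isOpen_lt hV continuous_const) hopen'
    ?_ ?_ ?_ hEc hz
  · rw [Set.disjoint_left]
    intro y hy hy'
    exact hy.ne hy'.1.1
  · intro y hy
    rcases (hle y).lt_or_eq with h | h
    · exact Or.inl h
    · exact Or.inr ⟨⟨h, fun hyS => hy (hSE hyS)⟩, hy⟩
  · have hn : 7 * R ≤ ‖((7 * R : ℝ) : ℂ)‖ := by
      rw [Complex.norm_real]
      exact le_abs_self _
    refine ⟨((7 * R : ℝ) : ℂ), fun h => ?_, potential_lt_energy_of_far hR hSR hν hn⟩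
    have := hER h
    rw [mem_closedBall_zero_iff] at this
    linarith

lemma energy_le_of_isEquilibriumMeasure {D : ℝ} {η : ProbabilityMeasure ℂ} (hD : 1 ≤ D)
    (hdiam : ∀ z ∈ E, ∀ w ∈ E, ‖z - w‖ ≤ D) (hη : JuliaApprox.IsEquilibriumMeasure E η)
    {μ : Measure ℂ} [IsProbabilityMeasure μ] (hμ : μ Eᶜ = 0) : energy D η ≤ energy D μ := by
  have h : JuliaApprox.logEnergy μ ≤ JuliaApprox.logEnergy (η : Measure ℂ) := by
    rw [hη.2]
    exact le_iSup₂ (f := fun (μ : ProbabilityMeasure ℂ) (_ : μ ∈ JuliaApprox.probOn E) =>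
      JuliaApprox.logEnergy (μ : Measure ℂ)) (⟨μ, inferInstance⟩ : ProbabilityMeasure ℂ) hμ
  rw [logEnergy_eq hD hdiam hμ, logEnergy_eq hD hdiam hη.1] at h
  by_contra! hlt
  have hfin : energy D μ ≠ ⊤ := hlt.ne_top
  generalize energy D μ = e at *
  generalize energy D (η : Measure ℂ) = e' at *
  lift e to ℝ≥0 using hfin
  induction e' with
  | top =>
    rw [EReal.coe_ennreal_top, EReal.sub_top, le_bot_iff] at h
    exact EReal.coe_ne_bot (Real.log D - e) h
  | coe e' =>
    have h' : ((Real.log D - e : ℝ) : EReal) ≤ ((Real.log D - e' : ℝ) : EReal) := h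
    rw [EReal.coe_le_coe_iff] at h'
    have h'' : (e : ℝ) < e' := by exact_mod_cast hlt
    linarith

lemma logCapacity_eq {D : ℝ} {η : ProbabilityMeasure ℂ} (hD : 1 ≤ D)
    (hdiam : ∀ z ∈ E, ∀ w ∈ E, ‖z - w‖ ≤ D) (hη : JuliaApprox.IsEquilibriumMeasure E η)
    (hfin : energy D η ≠ ⊤) :
    JuliaApprox.logCapacity E = D * Real.exp (-(energy D η).toReal) := by
  rw [JuliaApprox.logCapacity, ← hη.2, logEnergy_eq hD hdiam hη.1]
  generalize energy D (η : Measure ℂ) = e at *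
  lift e to ℝ≥0 using hfin
  have h : ((Real.log D : ℝ) : EReal) - ((e : ℝ≥0∞) : EReal) = ((Real.log D - e : ℝ) : EReal) :=
    rfl
  rw [h, EReal.exp_coe, ENNReal.toReal_ofReal (Real.exp_pos _).le, sub_eq_add_neg, Real.exp_add,
    Real.exp_log (by linarith)]
  rfl

/-- Frostman's theorem for a uniformly perfect set with connected complement: the equilibrium
potential is continuous, equal to the energy on the set and smaller outside. -/
theorem frostman {R : ℝ} {E : Set ℂ} {η : ProbabilityMeasure ℂ} (hE : IsCompact E)
    (hEc : IsPreconnected Eᶜ) (hup : JuliaApprox.IsUniformlyPerfect E) (hd : 0 < Metric.diam E)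
    (hη : JuliaApprox.IsEquilibriumMeasure E η) (hR : 1 ≤ R) (hER : E ⊆ Metric.closedBall 0 R) :
    energy (16 * R) η ≠ ⊤ ∧ Continuous (potential (16 * R) η) ∧
      (∀ z ∈ E, potential (16 * R) η z = energy (16 * R) η) ∧
      (∀ z ∉ E, potential (16 * R) η z < energy (16 * R) η) := by
  have hR0 : 0 < R := by linarith
  have hD : 0 < 16 * R := by positivity
  have hdiam : ∀ z ∈ E, ∀ w ∈ E, ‖z - w‖ ≤ 16 * R := by
    intro z hz w hw
    have h1 := mem_closedBall_zero_iff.1 (hER hz)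
    have h2 := mem_closedBall_zero_iff.1 (hER hw)
    have := norm_sub_le z w
    linarith
  have hmin : ∀ μ : Measure ℂ, IsProbabilityMeasure μ → μ Eᶜ = 0 →
      energy (16 * R) η ≤ energy (16 * R) μ := fun μ hμ hμE =>
    energy_le_of_isEquilibriumMeasure (by linarith) hdiam hη hμE
  have hν : ∀ᵐ w ∂(η : Measure ℂ), w ∈ E := hη.1
  obtain ⟨a₀, ha₀, hup₀⟩ := hup
  obtain ⟨a, ha, ha1, hup⟩ : ∃ a : ℝ, 0 < a ∧ a ≤ 1 ∧ ∀ z ∈ E, ∀ r : ℝ, 0 < r →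
      r < Metric.diam E → ∃ w ∈ E, a * r ≤ ‖z - w‖ ∧ ‖z - w‖ ≤ r := by
    refine ⟨min a₀ 1, by positivity, min_le_right _ _, fun z hz r hr hrd => ?_⟩
    obtain ⟨w, hw, h1, h2⟩ := hup₀ z hz r hr hrd
    refine ⟨w, hw, le_trans ?_ h1, h2⟩
    gcongr
    exact min_le_left _ _
  have hfin : energy (16 * R) η ≠ ⊤ := by
    obtain ⟨z, hz⟩ : E.Nonempty := by
      by_contra h
      rw [Set.not_nonempty_iff_eq_empty.1 h, Metric.diam_empty] at hd
      exact lt_irrefl _ hd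
    obtain ⟨μ, hμ, hμE, hμV⟩ := exists_measure_potential_le hE.isClosed hD ha ha1 hup hz
      (half_pos hd) (half_lt_self hd)
    have hμE' : ∀ᵐ w ∂μ, w ∈ E := hμE.mono fun w hw => hw.1
    refine ne_top_of_le_ne_top ?_ ((hmin μ hμ hμE').trans (lintegral_mono hμV))
    rw [lintegral_const]
    finiteness
  have hvar : ∀ μ : Measure ℂ, IsProbabilityMeasure μ → μ Eᶜ = 0 → energy (16 * R) μ ≠ ⊤ →
      energy (16 * R) η ≤ ∫⁻ z, potential (16 * R) η z ∂μ := by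
    intro μ hμ hμE hμfin
    refine energy_le_lintegral_potential hfin hμfin fun t ht0 ht1 => hmin _ ⟨?_⟩ ?_
    · simp only [Measure.coe_add, Measure.coe_smul, Pi.add_apply, Pi.smul_apply, measure_univ,
        smul_eq_mul, mul_one]
      rw [← ENNReal.ofReal_add (by linarith) ht0.le]
      simp
    · have hη0 : (η : Measure ℂ) Eᶜ = 0 := hη.1
      simp [hμE, hη0]
  have hreg : ∀ z ∈ E, energy (16 * R) η ≤ potential (16 * R) η z := fun z hz =>
    energy_le_potential hE.isClosed hD ha ha1 hd hup hvar hz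
  obtain ⟨S, hSE, hS, hνS, hSγ⟩ := exists_closed_carrier hE.isClosed hν hfin hreg
  refine ⟨hfin, continuous_potential hD hS hνS hfin hSγ, fun z hz => ?_, fun z hz => ?_⟩
  · exact le_antisymm (potential_le_energy hR0 hS (hSE.trans hER) hνS hfin hSγ z) (hreg z hz)
  · exact potential_lt_energy_of_notMem hR0 hE.isClosed hEc hER hS hSE hνS hfin hSγ hz

end

/-! ### Asymptotics of polynomials with prescribed zero distribution -/

lemma integral_zeroCountingMeasure (p : ℂ[X]) (f : ℂ → ℝ) :
    ∫ w, f w ∂(JuliaApprox.zeroCountingMeasure p : Measure ℂ) =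
      (p.natDegree : ℝ)⁻¹ * (p.roots.map f).sum := by
  have h : ∀ m : Multiset ℂ,
      Integrable f
        ((m.map fun ζ => (diracProba ζ).toFiniteMeasure).sum : FiniteMeasure ℂ) ∧
      ∫ w, f w ∂((m.map fun ζ => (diracProba ζ).toFiniteMeasure).sum : FiniteMeasure ℂ) =
        (m.map f).sum := by
    intro m
    induction m using Multiset.induction_on with
    | empty => simp
    | cons ζ m ih =>
      have h0 : (((diracProba ζ).toFiniteMeasure : FiniteMeasure ℂ) : Measure ℂ) =
        Measure.dirac ζ := rfl
      have h1 : Integrable f (Measure.dirac ζ) := integrable_dirac (by simp)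
      simp only [Multiset.map_cons, Multiset.sum_cons, FiniteMeasure.toMeasure_add, h0]
      refine ⟨h1.add_measure ih.1, ?_⟩
      rw [integral_add_measure h1 ih.1, integral_dirac, ih.2]
  rw [JuliaApprox.zeroCountingMeasure, FiniteMeasure.toMeasure_smul, integral_smul_nnreal_measure,
    (h _).2, NNReal.smul_def]
  simp

lemma norm_eval_eq_prod {p : ℂ[X]} (hp : p.Monic) (z : ℂ) :
    ‖p.eval z‖ = (p.roots.map fun ζ => ‖z - ζ‖).prod := by
  rw [(IsAlgClosed.splits p).eval_eq_prod_roots_of_monic hp]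
  have := map_multiset_prod (normHom : ℂ →*₀ ℝ) (p.roots.map fun ζ => z - ζ)
  simpa [Multiset.map_map, Function.comp_def] using this

lemma pow_mul_prod_map_norm (m : Multiset ℂ) (c : ℝ) (z : ℂ) :
    (m.map fun ζ => c * ‖z - ζ‖).prod = c ^ m.card * (m.map fun ζ => ‖z - ζ‖).prod := by
  rw [Multiset.prod_map_mul]
  simp

lemma log_norm_eval_eq_sum {p : ℂ[X]} (hp : p.Monic) {z : ℂ} (hz : ∀ ζ ∈ p.roots, z ≠ ζ) :
    Real.log ‖p.eval z‖ = (p.roots.map fun ζ => Real.log ‖z - ζ‖).sum := by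
  rw [norm_eval_eq_prod hp]
  generalize p.roots = m at hz
  induction m using Multiset.induction_on with
  | empty => simp
  | cons ζ m ih =>
    have hne : ∀ ξ ∈ ζ ::ₘ m, ‖z - ξ‖ ≠ 0 := fun ξ hξ =>
      norm_ne_zero_iff.2 (sub_ne_zero.2 (hz ξ hξ))
    have hprod : (m.map fun ζ => ‖z - ζ‖).prod ≠ 0 := by
      refine Multiset.prod_ne_zero fun h => ?_
      obtain ⟨ξ, hξ, h0⟩ := Multiset.mem_map.1 h
      exact hne ξ (Multiset.mem_cons_of_mem hξ) h0
    rw [Multiset.map_cons, Multiset.map_cons, Multiset.prod_cons, Multiset.sum_cons,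
      Real.log_mul (hne ζ (Multiset.mem_cons_self ζ m)) hprod,
      ih fun ξ hξ => hz ξ (Multiset.mem_cons_of_mem hξ)]

/-- Comparison of the values of a monic polynomial at two points, through the distances of the
points to the zeros. -/
lemma norm_eval_le {p : ℂ[X]} (hp : p.Monic) {z z' : ℂ} {c : ℝ}
    (h : ∀ ζ ∈ p.roots, ‖z - ζ‖ ≤ c * ‖z' - ζ‖) :
    ‖p.eval z‖ ≤ c ^ p.natDegree * ‖p.eval z'‖ := by
  rw [norm_eval_eq_prod hp, norm_eval_eq_prod hp,
    (IsAlgClosed.splits p).natDegree_eq_card_roots, ← pow_mul_prod_map_norm]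
  exact Multiset.prod_map_le_prod_map₀ _ _ (fun ζ _ => norm_nonneg _) h

lemma pow_natDegree_le_norm_eval {p : ℂ[X]} (hp : p.Monic) {z : ℂ} {c : ℝ} (hc : 0 ≤ c)
    (h : ∀ ζ ∈ p.roots, c ≤ ‖z - ζ‖) : c ^ p.natDegree ≤ ‖p.eval z‖ := by
  rw [norm_eval_eq_prod hp, (IsAlgClosed.splits p).natDegree_eq_card_roots]
  have := Multiset.prod_map_le_prod_map₀ (s := p.roots) (fun _ => c) _ (fun _ _ => hc) h
  simpa using this

section Asymptotics

variable {E : Set ℂ} {q : ℕ → ℂ[X]}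

/-- Weak convergence of the zero distributions gives convergence of the normalized logarithms of
the polynomials at each point off the set that contains the zeros. -/
lemma tendsto_log_norm_eval_div {D : ℝ} {η : ProbabilityMeasure ℂ} (hD : 0 < D)
    (hE : IsClosed E) (hne : E.Nonempty) (hη : (η : Measure ℂ) Eᶜ = 0)
    (hq_monic : ∀ n : ℕ, 1 ≤ n → (q n).Monic) (hq_deg : ∀ n : ℕ, 1 ≤ n → (q n).natDegree = n)
    (hq_zeros : ∀ n : ℕ, 1 ≤ n → ∀ ζ ∈ (q n).roots, ζ ∈ E)
    (hq_lim : Tendsto (fun n : ℕ => JuliaApprox.zeroCountingMeasure (q n)) atTop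
      (𝓝 η.toFiniteMeasure))
    {z : ℂ} (hz : z ∉ E) (hzD : ∀ w ∈ E, ‖z - w‖ ≤ D) :
    Tendsto (fun n : ℕ => Real.log ‖(q n).eval z‖ / n) atTop
      (𝓝 (Real.log D - (potential D η z).toReal)) := by
  obtain ⟨ρ, hρ, hρE⟩ := exists_pos_forall_le_norm_sub hE hz
  have hρD : ρ ≤ D := by
    obtain ⟨w, hw⟩ := hne
    exact (hρE w hw).trans (hzD w hw)
  -- Clamping `|z - w|` between `ρ` and `D` changes nothing on `E` and makes a test function.
  set f : ℂ → ℝ := fun w => Real.log (min D (max ρ ‖z - w‖)) with hf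
  have hpos : ∀ w, ρ ≤ min D (max ρ ‖z - w‖) := fun w => le_min hρD (le_max_left _ _)
  have hfc : Continuous f :=
    Continuous.log (by fun_prop) fun w => (hρ.trans_le (hpos w)).ne'
  have hfb : ∀ w, ‖f w‖ ≤ |Real.log ρ| + |Real.log D| := by
    intro w
    have h1 := Real.log_le_log hρ (hpos w)
    have h2 := Real.log_le_log (hρ.trans_le (hpos w)) (min_le_left D (max ρ ‖z - w‖))
    rw [Real.norm_eq_abs, abs_le]
    have h3 := neg_abs_le (Real.log ρ)
    have h4 := le_abs_self (Real.log D)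
    have h5 := abs_nonneg (Real.log ρ)
    have h6 := abs_nonneg (Real.log D)
    constructor <;> simp only [hf] <;> linarith
  have hfE : ∀ w ∈ E, f w = Real.log ‖z - w‖ := by
    intro w hw
    rw [hf]
    simp only
    rw [max_eq_right (hρE w hw), min_eq_right (hzD w hw)]
  have hneE : ∀ w ∈ E, z ≠ w := fun w hw h => hz (h ▸ hw)
  have hlim := FiniteMeasure.tendsto_iff_forall_integral_tendsto.1 hq_lim
    (BoundedContinuousFunction.ofNormedAddCommGroup f hfc _ hfb)
  simp only [BoundedContinuousFunction.coe_ofNormedAddCommGroup] at hlim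
  have hηE : ∀ᵐ w ∂(η : Measure ℂ), w ∈ E := hη
  have hint : ∫ w, f w ∂(η : Measure ℂ) = Real.log D - (potential D η z).toReal := by
    have hfin : ∀ᵐ w ∂(η : Measure ℂ), logKernel D z w < ⊤ := by
      filter_upwards [hηE] with w hw
      rw [logKernel_of_ne hD (hneE w hw)]
      exact ENNReal.ofReal_lt_top
    have hKf : ∀ᵐ w ∂(η : Measure ℂ), (logKernel D z w).toReal = Real.log D - f w := by
      filter_upwards [hηE] with w hw
      have h1 := hρ.trans_le (hρE w hw)
      rw [hfE w hw, logKernel_of_ne hD (hneE w hw), Real.log_div hD.ne' h1.ne',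
        ENNReal.toReal_ofReal]
      have := Real.log_le_log h1 (hzD w hw)
      linarith
    have hfi : Integrable f (η : Measure ℂ) :=
      Integrable.of_bound hfc.aestronglyMeasurable _ (Eventually.of_forall hfb)
    rw [potential, ← integral_toReal (continuous_logKernel_right D z).measurable.aemeasurable hfin,
      integral_congr_ae hKf, integral_sub (integrable_const _) hfi]
    simp
  have hlim' : Tendsto (fun n => ∫ w, f w ∂(JuliaApprox.zeroCountingMeasure (q n) : Measure ℂ))
      atTop (𝓝 (Real.log D - (potential D η z).toReal)) := hint ▸ hlim
  refine hlim'.congr' ?_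
  filter_upwards [eventually_ge_atTop 1] with n hn
  rw [integral_zeroCountingMeasure, hq_deg n hn, log_norm_eval_eq_sum (hq_monic n hn)
    fun ζ hζ => hneE ζ (hq_zeros n hn ζ hζ), inv_mul_eq_div,
    Multiset.map_congr rfl fun ζ hζ => hfE ζ (hq_zeros n hn ζ hζ)]

/-- A pointwise upper bound off the zeros is locally uniform, because moving `z` by a small
proportion of its distance to the zeros changes each linear factor by a factor close to `1`. -/
lemma eventually_norm_eval_le_exp {C : Set ℂ} (hE : IsClosed E) (hC : IsCompact C)
    (hCE : Disjoint C E)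
    (hq_monic : ∀ n : ℕ, 1 ≤ n → (q n).Monic) (hq_deg : ∀ n : ℕ, 1 ≤ n → (q n).natDegree = n)
    (hq_zeros : ∀ n : ℕ, 1 ≤ n → ∀ ζ ∈ (q n).roots, ζ ∈ E) {L : ℂ → ℝ} {β : ℝ}
    (hL : ∀ z ∈ C, Tendsto (fun n : ℕ => Real.log ‖(q n).eval z‖ / n) atTop (𝓝 (L z)))
    (hβ : ∀ z ∈ C, L z < β) :
    ∀ᶠ n : ℕ in atTop, ∀ z ∈ C, ‖(q n).eval z‖ ≤ Real.exp (n * β) := by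
  refine hC.induction_on (p := fun s => ∀ᶠ n : ℕ in atTop, ∀ z ∈ s,
    ‖(q n).eval z‖ ≤ Real.exp (n * β)) (by simp) ?_ ?_ ?_
  · exact fun s t hst h => h.mono fun n hn z hz => hn z (hst hz)
  · intro s t hs ht
    filter_upwards [hs, ht] with n h1 h2 z hz
    exact hz.elim (h1 z) (h2 z)
  · intro z₀ hz₀
    obtain ⟨β', hβ', hβ'β⟩ := exists_between (hβ z₀ hz₀)
    obtain ⟨ρ, hρ, hρE⟩ := exists_pos_forall_le_norm_sub hE (Set.disjoint_left.1 hCE hz₀)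
    refine ⟨Metric.ball z₀ (ρ * (β - β')), mem_nhdsWithin_of_mem_nhds
      (Metric.ball_mem_nhds z₀ (mul_pos hρ (by linarith))), ?_⟩
    filter_upwards [(hL z₀ hz₀).eventually (gt_mem_nhds hβ'), eventually_ge_atTop 1] with n h1 hn z hz
    rw [Metric.mem_ball, dist_eq_norm] at hz
    have hn0 : (0 : ℝ) < n := by exact_mod_cast hn
    have h2 : ‖(q n).eval z₀‖ ≤ Real.exp (n * β') := by
      rw [div_lt_iff₀ hn0, mul_comm] at h1
      exact (Real.le_exp_log _).trans (Real.exp_le_exp.2 h1.le)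
    have h3 := norm_eval_le (hq_monic n hn) (z := z) (z' := z₀) (c := Real.exp (β - β'))
      fun ζ hζ => by
        have h4 := hρE ζ (hq_zeros n hn ζ hζ)
        have h5 := norm_sub_le_norm_sub_add_norm_sub z z₀ ζ
        have h6 := Real.add_one_le_exp (β - β')
        nlinarith
    rw [hq_deg n hn, ← Real.exp_nat_mul] at h3
    refine h3.trans ((mul_le_mul_of_nonneg_left h2 (Real.exp_pos _).le).trans_eq ?_)
    rw [← Real.exp_add]
    congr 1
    ring

lemma eventually_exp_le_norm_eval {C : Set ℂ} (hE : IsClosed E) (hC : IsCompact C)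
    (hCE : Disjoint C E)
    (hq_monic : ∀ n : ℕ, 1 ≤ n → (q n).Monic) (hq_deg : ∀ n : ℕ, 1 ≤ n → (q n).natDegree = n)
    (hq_zeros : ∀ n : ℕ, 1 ≤ n → ∀ ζ ∈ (q n).roots, ζ ∈ E) {L : ℂ → ℝ} {β : ℝ}
    (hL : ∀ z ∈ C, Tendsto (fun n : ℕ => Real.log ‖(q n).eval z‖ / n) atTop (𝓝 (L z)))
    (hβ : ∀ z ∈ C, β < L z) :
    ∀ᶠ n : ℕ in atTop, ∀ z ∈ C, Real.exp (n * β) ≤ ‖(q n).eval z‖ := by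
  refine hC.induction_on (p := fun s => ∀ᶠ n : ℕ in atTop, ∀ z ∈ s,
    Real.exp (n * β) ≤ ‖(q n).eval z‖) (by simp) ?_ ?_ ?_
  · exact fun s t hst h => h.mono fun n hn z hz => hn z (hst hz)
  · intro s t hs ht
    filter_upwards [hs, ht] with n h1 h2 z hz
    exact hz.elim (h1 z) (h2 z)
  · intro z₀ hz₀
    obtain ⟨β', hββ', hβ'⟩ := exists_between (hβ z₀ hz₀)
    obtain ⟨ρ, hρ, hρE⟩ := exists_pos_forall_le_norm_sub hE (Set.disjoint_left.1 hCE hz₀)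
    have hexp : Real.exp (-(β' - β)) < 1 := Real.exp_lt_one_iff.2 (by linarith)
    have hexp0 := Real.exp_pos (-(β' - β))
    refine ⟨Metric.ball z₀ (ρ * (1 - Real.exp (-(β' - β)))), mem_nhdsWithin_of_mem_nhds
      (Metric.ball_mem_nhds z₀ (mul_pos hρ (by linarith))), ?_⟩
    filter_upwards [(hL z₀ hz₀).eventually (lt_mem_nhds hβ'), eventually_ge_atTop 1] with n h1 hn z hz
    rw [Metric.mem_ball, dist_eq_norm] at hz
    have hn0 : (0 : ℝ) < n := by exact_mod_cast hn
    have h2 : Real.exp (n * β') ≤ ‖(q n).eval z₀‖ := by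
      have hpos : 0 < ‖(q n).eval z₀‖ :=
        (pow_pos hρ _).trans_le (pow_natDegree_le_norm_eval (hq_monic n hn) hρ.le
          fun ζ hζ => hρE ζ (hq_zeros n hn ζ hζ))
      rw [lt_div_iff₀ hn0, mul_comm] at h1
      rw [← Real.exp_log hpos]
      exact Real.exp_le_exp.2 h1.le
    have h3 := norm_eval_le (hq_monic n hn) (z := z₀) (z' := z) (c := Real.exp (β' - β))
      fun ζ hζ => by
        have h4 := hρE ζ (hq_zeros n hn ζ hζ)
        have h5 := norm_sub_le_norm_sub_add_norm_sub z₀ z ζ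
        rw [norm_sub_rev z₀ z] at h5
        have h6 : Real.exp (-(β' - β)) * ‖z₀ - ζ‖ ≤ ‖z - ζ‖ := by nlinarith
        rwa [Real.exp_neg, inv_mul_le_iff₀ (Real.exp_pos _)] at h6
    rw [hq_deg n hn, ← Real.exp_nat_mul] at h3
    have h4 := h2.trans h3
    have h5 : Real.exp (n * β') = Real.exp (n * (β' - β)) * Real.exp (n * β) := by
      rw [← Real.exp_add]
      congr 1
      ring
    rw [h5] at h4
    exact le_of_mul_le_mul_left h4 (Real.exp_pos _)

end Asymptotics

/-! ### Bounded and escaping orbits -/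

lemma subset_filledJulia_of_mapsTo {P : ℂ[X]} {V : Set ℂ} (hV : Bornology.IsBounded V)
    (hP : Set.MapsTo (fun w => P.eval w) V V) : V ⊆ JuliaApprox.filledJulia P := by
  intro z hz h
  have h1 : ∀ᶠ m : ℕ in atTop, (fun w => P.eval w)^[m] z ∈ Vᶜ := h (Bornology.isBounded_def.1 hV)
  obtain ⟨m, hm⟩ := h1.exists
  exact hm (hP.iterate m hz)

lemma notMem_filledJulia_of_mapsTo {P : ℂ[X]} {A : Set ℂ} (h0 : (0 : ℂ) ∉ A)
    (hP : Set.MapsTo (fun w => P.eval w) A A) (hP2 : ∀ z ∈ A, 2 * ‖z‖ ≤ ‖P.eval z‖) {z : ℂ}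
    (hz : z ∈ A) : z ∉ JuliaApprox.filledJulia P := by
  refine not_not.2 ?_
  have hz0 : 0 < ‖z‖ := norm_pos_iff.2 fun h => h0 (h ▸ hz)
  have h : ∀ m : ℕ, 2 ^ m * ‖z‖ ≤ ‖(fun w => P.eval w)^[m] z‖ := by
    intro m
    induction m with
    | zero => simp
    | succ m ih =>
      rw [Function.iterate_succ_apply', pow_succ]
      have := hP2 _ (hP.iterate m hz)
      linarith
  rw [← tendsto_norm_atTop_iff_cobounded]
  exact tendsto_atTop_mono h
    ((tendsto_pow_atTop_atTop_of_one_lt one_lt_two).atTop_mul_const hz0)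

/-! ### The approximating polynomials -/

lemma norm_eval_approxPoly {E : Set ℂ} {ℓ : ℝ} (hℓ : JuliaApprox.logCapacity E = Real.exp ℓ)
    (q : ℕ → ℂ[X]) (n : ℕ) (s : ℝ) (z : ℂ) :
    ‖(JuliaApprox.approxPoly E q n s).eval z‖ =
      ‖z‖ * (Real.exp (-(n * s) / 2 - n * ℓ) * ‖(q n).eval z‖) := by
  have h : Real.exp (-(n * s) / 2) / JuliaApprox.logCapacity E ^ n =
      Real.exp (-(n * s) / 2 - n * ℓ) := by
    rw [hℓ, ← Real.exp_nat_mul, ← Real.exp_sub]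
  rw [JuliaApprox.approxPoly, eval_mul, eval_mul, eval_X, eval_C, norm_mul, norm_mul, h,
    Complex.norm_real, Real.norm_of_nonneg (Real.exp_pos _).le, mul_assoc]

/-- The growth of the polynomials relative to the capacity `exp ℓ`: at an exponential rate off a
neighbourhood `U` of `E`, and at an arbitrarily small rate near `E`. -/
theorem exists_growth_bounds {E : Set ℂ} {η : ProbabilityMeasure ℂ} {q : ℕ → ℂ[X]}
    (hE : IsCompact E) (hEc : IsPreconnected Eᶜ) (hup : JuliaApprox.IsUniformlyPerfect E)
    (hd : 0 < Metric.diam E) (hη : JuliaApprox.IsEquilibriumMeasure E η)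
    (hq_monic : ∀ n : ℕ, 1 ≤ n → (q n).Monic) (hq_deg : ∀ n : ℕ, 1 ≤ n → (q n).natDegree = n)
    (hq_zeros : ∀ n : ℕ, 1 ≤ n → ∀ ζ ∈ (q n).roots, ζ ∈ E)
    (hq_lim : Tendsto (fun n : ℕ => JuliaApprox.zeroCountingMeasure (q n)) atTop
      (𝓝 η.toFiniteMeasure))
    {U : Set ℂ} (hU : IsOpen U) (hEU : E ⊆ U) :
    ∃ ℓ : ℝ, JuliaApprox.logCapacity E = Real.exp ℓ ∧
      (∃ s : ℝ, 0 < s ∧ ∀ᶠ n : ℕ in atTop, ∀ z ∉ U,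
        Real.exp (n * (ℓ + s)) ≤ ‖(q n).eval z‖) ∧
      ∀ ε : ℝ, 0 < ε → ∃ V : Set ℂ, IsOpen V ∧ Bornology.IsBounded V ∧ E ⊆ V ∧
        ∀ᶠ n : ℕ in atTop, ∀ z ∈ V, ‖(q n).eval z‖ ≤ Real.exp (n * (ℓ + ε)) := by
  obtain ⟨R, hR, hER⟩ : ∃ R : ℝ, 1 ≤ R ∧ E ⊆ Metric.closedBall 0 R := by
    obtain ⟨R, hR⟩ := hE.isBounded.subset_closedBall 0
    exact ⟨max 1 R, le_max_left _ _, hR.trans (Metric.closedBall_subset_closedBall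
      (le_max_right _ _))⟩
  have hR0 : 0 < R := by linarith
  have hD : 0 < 16 * R := by positivity
  have hER' : ∀ w ∈ E, ‖w‖ ≤ R := fun w hw => mem_closedBall_zero_iff.1 (hER hw)
  have hEne : E.Nonempty := by
    by_contra h
    rw [Set.not_nonempty_iff_eq_empty.1 h, Metric.diam_empty] at hd
    exact lt_irrefl _ hd
  obtain ⟨hfin, hVc, hVE, hVlt⟩ := frostman hE hEc hup hd hη hR hER
  set γ := (energy (16 * R) η).toReal with hγ
  set v : ℂ → ℝ := fun z => (potential (16 * R) η z).toReal with hv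
  have hVtop : ∀ z, potential (16 * R) η z ≠ ⊤ := by
    intro z
    by_cases hz : z ∈ E
    · rwa [hVE z hz]
    · exact (hVlt z hz).ne_top
  have hvc : Continuous v :=
    continuous_iff_continuousAt.2 fun z =>
      (ENNReal.continuousAt_toReal (hVtop z)).comp hVc.continuousAt
  have hvE : ∀ z ∈ E, v z = γ := fun z hz => by rw [hγ, ← hVE z hz]
  have hvlt : ∀ z ∉ E, v z < γ := fun z hz =>
    (ENNReal.toReal_lt_toReal (hVtop z) hfin).2 (hVlt z hz)
  have hγ8 : Real.log 8 ≤ γ := by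
    rw [hγ, ← ENNReal.ofReal_le_iff_le_toReal hfin]
    exact ofReal_log_eight_le_energy hR0 hER hη.1
  set ℓ := Real.log (16 * R) - γ with hℓ
  have hcap : JuliaApprox.logCapacity E = Real.exp ℓ := by
    rw [logCapacity_eq (D := 16 * R) (by linarith) (fun z hz w hw => ?_) hη hfin, hℓ,
      sub_eq_add_neg, Real.exp_add, Real.exp_log hD]
    have := norm_sub_le z w
    linarith [hER' z hz, hER' w hw]
  have hL : ∀ z ∈ Metric.closedBall (0 : ℂ) (15 * R), z ∉ E →
      Tendsto (fun n : ℕ => Real.log ‖(q n).eval z‖ / n) atTop (𝓝 (Real.log (16 * R) - v z)) := by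
    intro z hz hzE
    refine tendsto_log_norm_eval_div hD hE.isClosed hEne hη.1 hq_monic hq_deg hq_zeros hq_lim hzE
      fun w hw => ?_
    rw [mem_closedBall_zero_iff] at hz
    have := norm_sub_le z w
    linarith [hER' w hw]
  refine ⟨ℓ, hcap, ?_, ?_⟩
  · have hC : IsCompact (Metric.closedBall (0 : ℂ) (15 * R) \ U) :=
      (isCompact_closedBall _ _).diff hU
    have hCE : ∀ z ∈ Metric.closedBall (0 : ℂ) (15 * R) \ U, z ∉ E := fun z hz hzE =>
      hz.2 (hEU hzE)
    obtain ⟨s, hs, hs1, hsv⟩ : ∃ s : ℝ, 0 < s ∧ s ≤ 1 ∧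
        ∀ z ∈ Metric.closedBall (0 : ℂ) (15 * R) \ U, v z < γ - s := by
      rcases Set.eq_empty_or_nonempty (Metric.closedBall (0 : ℂ) (15 * R) \ U) with h | h
      · exact ⟨1, one_pos, le_rfl, by simp [h]⟩
      · obtain ⟨x, hx, hmax⟩ := hC.exists_isMaxOn h hvc.continuousOn
        have hxγ := hvlt x (hCE x hx)
        refine ⟨min 1 ((γ - v x) / 2), lt_min one_pos (by linarith), min_le_left _ _,
          fun z hz => ?_⟩
        have h1 : v z ≤ v x := hmax hz
        have h2 := min_le_right 1 ((γ - v x) / 2)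
        linarith
    refine ⟨s, hs, ?_⟩
    filter_upwards [eventually_exp_le_norm_eval hE.isClosed hC
      (Set.disjoint_left.2 hCE) hq_monic hq_deg hq_zeros (fun z hz => hL z hz.1 (hCE z hz))
      (β := ℓ + s) (fun z hz => by linarith [hsv z hz]), eventually_ge_atTop 1] with n hn hn1 z hz
    by_cases hzR : z ∈ Metric.closedBall (0 : ℂ) (15 * R)
    · exact hn z ⟨hzR, hz⟩
    · -- Far away every factor is at least `14 R`, while `exp (ℓ + s) ≤ (16 R / 8) e`.
      rw [mem_closedBall_zero_iff, not_le] at hzR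
      have h1 := pow_natDegree_le_norm_eval (hq_monic n hn1) (z := z) (c := 14 * R) (by positivity)
        fun ζ hζ => by
          have := norm_sub_norm_le z ζ
          linarith [hER' ζ (hq_zeros n hn1 ζ hζ)]
      rw [hq_deg n hn1] at h1
      refine le_trans ?_ h1
      rw [Real.exp_nat_mul]
      gcongr
      have h2 : ℓ + s ≤ Real.log (16 * R / 8) + 1 := by
        rw [Real.log_div hD.ne' (by norm_num)]
        linarith
      refine (Real.exp_le_exp.2 h2).trans ?_
      rw [Real.exp_add, Real.exp_log (by positivity)]
      nlinarith [Real.exp_one_lt_d9]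
  · intro ε hε
    have hW : IsOpen ({z | γ - ε < v z} ∩ Metric.ball (0 : ℂ) (15 * R)) :=
      (isOpen_lt continuous_const hvc).inter Metric.isOpen_ball
    obtain ⟨δ, hδ, hδW⟩ := hE.exists_cthickening_subset_open hW fun z hz => by
      refine ⟨?_, ?_⟩
      · change γ - ε < v z
        rw [hvE z hz]
        linarith
      · rw [mem_ball_zero_iff]
        linarith [hER' z hz]
    have hVb : Bornology.IsBounded (Metric.thickening δ E) := hE.isBounded.thickening
    refine ⟨Metric.thickening δ E, Metric.isOpen_thickening, hVb,
      Metric.self_subset_thickening hδ E, ?_⟩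
    have hfr : frontier (Metric.thickening δ E) ⊆ Metric.cthickening δ E :=
      frontier_subset_closure.trans (Metric.closure_thickening_subset_cthickening δ E)
    have hfrE : ∀ z ∈ frontier (Metric.thickening δ E), z ∉ E := by
      intro z hz hzE
      rw [Metric.isOpen_thickening.frontier_eq] at hz
      exact hz.2 (Metric.self_subset_thickening hδ E hzE)
    have hC : IsCompact (frontier (Metric.thickening δ E)) :=
      hE.cthickening.of_isClosed_subset isClosed_frontier hfr
    filter_upwards [eventually_norm_eval_le_exp hE.isClosed hC (Set.disjoint_left.2 hfrE) hq_monic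
      hq_deg hq_zeros (fun z hz => hL z (Metric.ball_subset_closedBall (hδW (hfr hz)).2)
      (hfrE z hz)) (β := ℓ + ε) (fun z hz => by
        have : γ - ε < v z := (hδW (hfr hz)).1
        linarith)] with n hn z hz
    exact Complex.norm_le_of_forall_mem_frontier_norm_le hVb (q n).differentiable.diffContOnCl hn
      (subset_closure hz)

lemma eventually_lt_exp_nat_mul {c : ℝ} (hc : 0 < c) (M : ℝ) :
    ∀ᶠ n : ℕ in atTop, M < Real.exp (n * c) :=
  (Real.tendsto_exp_atTop.comp
    (tendsto_natCast_atTop_atTop.atTop_mul_const hc)).eventually_gt_atTop M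

end LogPotential

theorem theorem3p2
    (E : Set ℂ) (hE : IsCompact E) (hEc : IsConnected (Eᶜ : Set ℂ))
    (hE0 : (0 : ℂ) ∈ interior E) (hEup : JuliaApprox.IsUniformlyPerfect E)
    (ν : ProbabilityMeasure ℂ) (hν : JuliaApprox.IsEquilibriumMeasure E ν)
    (q : ℕ → ℂ[X])
    (hq_monic : ∀ n : ℕ, 1 ≤ n → (q n).Monic)
    (hq_deg : ∀ n : ℕ, 1 ≤ n → (q n).natDegree = n)
    (hq_zeros : ∀ n : ℕ, 1 ≤ n → ∀ ζ : ℂ, (q n).IsRoot ζ → ζ ∈ frontier E)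
    (hq_lim : Tendsto (fun n : ℕ => JuliaApprox.zeroCountingMeasure (q n)) atTop
      (𝓝 ν.toFiniteMeasure))
    (U : Set ℂ) (hU : U ∈ 𝓝ˢ E) (hUb : Bornology.IsBounded U) :
    ∃ s : ℝ, 0 < s ∧ ∃ n : ℕ, 1 ≤ n ∧
      E ⊆ interior (JuliaApprox.filledJulia (JuliaApprox.approxPoly E q n s)) ∧
      interior (JuliaApprox.filledJulia (JuliaApprox.approxPoly E q n s)) ⊆ U := by
  obtain ⟨r, hr, hrE⟩ := Metric.mem_nhds_iff.1 (mem_interior_iff_mem_nhds.1 hE0)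
  have hd : 0 < Metric.diam E := by
    have h1 : (0 : ℂ) ∈ E := interior_subset hE0
    have h2 : ((r / 2 : ℝ) : ℂ) ∈ E := hrE (by
      rw [mem_ball_zero_iff, Complex.norm_real, Real.norm_of_nonneg (by positivity)]
      linarith)
    refine lt_of_lt_of_le ?_ (Metric.dist_le_diam_of_mem hE.isBounded h1 h2)
    rw [dist_zero_left, Complex.norm_real, Real.norm_of_nonneg (by positivity)]
    positivity
  have hroots : ∀ n : ℕ, 1 ≤ n → ∀ ζ ∈ (q n).roots, ζ ∈ E := fun n hn ζ hζ =>
    hE.isClosed.frontier_subset (hq_zeros n hn ζ (isRoot_of_mem_roots hζ))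
  obtain ⟨ℓ, hℓ, ⟨s, hs, hfar⟩, hnear⟩ := LogPotential.exists_growth_bounds hE
    hEc.isPreconnected hEup hd hν hq_monic hq_deg hroots hq_lim isOpen_interior
    (subset_interior_iff_mem_nhdsSet.2 hU)
  -- The rate `s / 4` near `E` loses, and the rate `s` off `U` wins, against the factor `e^{-ns/2}`.
  obtain ⟨V, hVo, hVb, hEV, hV⟩ := hnear (s / 4) (by positivity)
  obtain ⟨M, hM0, hM⟩ := hVb.exists_pos_norm_le
  obtain ⟨R, hR0, hR⟩ := hUb.exists_pos_norm_le
  obtain ⟨n, hn1, hnfar, hnV, hn2, hnR, hnM⟩ := ((eventually_ge_atTop 1).and (hfar.and (hV.and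
    ((LogPotential.eventually_lt_exp_nat_mul (half_pos hs) 2).and
    ((LogPotential.eventually_lt_exp_nat_mul (half_pos hs) (R / r)).and
    (LogPotential.eventually_lt_exp_nat_mul (c := s / 4) (by positivity) (M / r))))))).exists
  refine ⟨s, hs, n, hn1, ?_, ?_⟩
  · refine hEV.trans (interior_maximal ?_ hVo)
    refine LogPotential.subset_filledJulia_of_mapsTo hVb fun z hz => hEV (hrE ?_)
    rw [mem_ball_zero_iff, LogPotential.norm_eval_approxPoly hℓ]
    calc ‖z‖ * (Real.exp (-(n * s) / 2 - n * ℓ) * ‖(q n).eval z‖)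
        ≤ M * (Real.exp (-(n * s) / 2 - n * ℓ) * Real.exp (n * (ℓ + s / 4))) := by
          gcongr
          exacts [hM z hz, hnV z hz]
      _ = M / Real.exp (n * (s / 4)) := by
          rw [← Real.exp_add, div_eq_mul_inv M, ← Real.exp_neg]
          congr 2
          ring
      _ < r := by
          rw [div_lt_iff₀ hr] at hnM
          rw [div_lt_iff₀ (Real.exp_pos _)]
          linarith
  · have hgrow : ∀ z ∉ interior U,
        ‖z‖ * Real.exp (n * (s / 2)) ≤ ‖(JuliaApprox.approxPoly E q n s).eval z‖ := by
      intro z hz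
      rw [LogPotential.norm_eval_approxPoly hℓ]
      have h : Real.exp (n * (s / 2)) =
          Real.exp (-(n * s) / 2 - n * ℓ) * Real.exp (n * (ℓ + s)) := by
        rw [← Real.exp_add]
        congr 1
        ring
      rw [h]
      gcongr
      exact hnfar z hz
    have hEU := subset_interior_iff_mem_nhdsSet.2 hU
    intro z hz
    by_contra hzU
    refine LogPotential.notMem_filledJulia_of_mapsTo (A := (interior U)ᶜ)
      (fun h => h (hEU (interior_subset hE0))) ?_ ?_ (fun h => hzU (interior_subset h))
      (interior_subset hz)
    · intro w hw hPw
      have hrw : r ≤ ‖w‖ := by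
        by_contra! h
        exact hw (hEU (hrE (mem_ball_zero_iff.2 h)))
      have h1 := hgrow w hw
      have h2 := hR _ (interior_subset hPw)
      rw [div_lt_iff₀ hr] at hnR
      have h3 : r * Real.exp (n * (s / 2)) ≤ ‖w‖ * Real.exp (n * (s / 2)) := by gcongr
      linarith
    · intro w hw
      have h1 := hgrow w hw
      have h2 : ‖w‖ * 2 ≤ ‖w‖ * Real.exp (n * (s / 2)) := by gcongr
      linarith
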